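/- Let $N\ge 2$, let $F_N$ be the free group with basis $A_N$, and let $\partial F_N$ be its Gromov boundary, identified with the set of infinite reduced words in $A_N\cup A_N^{-1}$; let $\overline{F_N}=F_N\cup\partial F_N$ be the compact space of finite and infinite reduced words, with the topology of letterwise convergence, and $\partial^2F_N=\{(X,Y)\in\partial F_N\times\partial F_N: X\ne Y\}$. An automorphism $\psi$ of $F_N$ extends to homeomorphisms of $\overline{F_N}$ (denoted $\partial\psi$ on $\partial F_N$) and of $\partial^2F_N$ (denoted $\partial^2\psi$, the diagonal map). A fixed point $X\in\partial F_N$ of $\partial\psi$ is *attracting* if it has a neighbourhood in $\overline{F_N}$ all of whose points converge to $X$ under iteration of $\psi$; a fixed point $(U,V)\in\partial^2F_N$ of $\partial^2\psi$ is *attracting* if it has such a neighbourhood in $\overline{F_N}\times\overline{F_N}$ for the diagonal map (in particular, it is attracting for the homeomorphism $\partial^2\psi$ of $\partial^2F_N$). For $w\in F_N$ put $i_w(u)=w^{-1}uw$. Automorphisms $\psi,\chi$ are *isogredient* if $\chi=i_v\circ\psi\circ i_{v^{-1}}$ for some $v\in F_N$. The *index* of $\psi$ is $$\mathbf{ind}(\psi)=\mathrm{rk}(\mathrm{Fix}(\psi))+\tfrac12\,(a(\psi)-2),$$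 where $\mathrm{Fix}(\psi)=\{u\in F_N:\psi(u)=u\}$ and $a(\psi)$ is the number of $\mathrm{Fix}(\psi)$-orbits of attracting points of $\partial\psi$ in $\partial F_N$. A nonempty reduced word is *pure positive* if all its letters are in $A_N$. Let $\varphi$ be an $A_N$-positive primitive automorphism of $F_N$: $\varphi(a)$ is pure positive for every $a\in A_N$, and there is $k\ge1$ such that for every $a\in A_N$ all elements of $A_N$ are letters of $\varphi^k(a)$. Let $\Phi_\infty=\{i_w\circ\varphi^k: w\in F_N,\ k\ge 1\}$. The *attracting subshift* $\Sigma_\varphi\subset\partial^2F_N$ is the closure in $\partial^2F_N$ of the two-sided orbit, under the shift $(X,Y)\mapsto(Y_0^{-1}X,Y_0^{-1}Y)$ ($Y_0$ the first letter of $Y$), of a point $$\Bigl(\lim_{n\to\infty}p^{-1}\varphi^k(p^{-1})\cdots\varphi^{nk}(p^{-1}),\ \lim_{n\to\infty}a\,s\,\varphi^k(s)\cdots\varphi^{nk}(s)\Bigr),$$ where $a\in A_N$, $k\ge1$ and $\varphi^k(a)=p\,a\,s$ with $p,s$ pure positive; it does not depend on the choice of $a,k,p,s$. **Theorem.** For every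 $\psi\in\Phi_\infty$ with $\mathbf{ind}(\psi)>0$ there exist $h\ge1$ and an automorphism $\psi'$ isogredient to $\psi^h$ such that $\partial^2\psi'$ has at least two (distinct) attracting points in $\Sigma_\varphi$. -/

import Mathlib

open Filter Topology

noncomputable section

namespace FreeBoundary

/-! ### The free group, its boundary and the compactification

The free group of rank `N` is `FreeGroup (Fin N)`. A letter is a pair `(a, b)`; `(a, true)` is the
basis element `a` and `(a, false)` is its inverse. -/

/-- The inclusion of the letters (basis elements and their inverses) in the free group. -/
def letter {N : ℕ} (l : Fin N × Bool) : FreeGroup (Fin N) := FreeGroup.mk [l]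

/-- The Gromov boundary: infinite reduced words (a letter is never followed by its inverse), with
the topology of letterwise convergence. -/
abbrev Boundary (N : ℕ) : Type :=
  {X : ℕ → Fin N × Bool // ∀ i, (X i).1 = (X (i + 1)).1 → (X i).2 = (X (i + 1)).2}

/-- The prefix of length `n` of an infinite reduced word. -/
def Boundary.pref {N : ℕ} (X : Boundary N) (n : ℕ) : FreeGroup (Fin N) :=
  FreeGroup.mk ((List.range n).map X.1)

/-- The compactification of the free group by its boundary: all finite and infinite reduced
words. -/
inductive Compactification (N : ℕ) : Type
  | word (g : FreeGroup (Fin N)) : Compactification N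
  | point (X : Boundary N) : Compactification N

/-- The `i`-th letter of a finite or infinite reduced word, `none` beyond the end of the word. -/
def Compactification.letters {N : ℕ} : Compactification N → ℕ → Option (Fin N × Bool)
  | .word g, i => g.toWord[i]?
  | .point X, i => some (X.1 i)

/-- The topology of letterwise convergence: neighbourhoods of an infinite word are given by common
prefixes, finite words are isolated. -/
instance (N : ℕ) : TopologicalSpace (Compactification N) :=
  TopologicalSpace.induced Compactification.letters
    (@Pi.topologicalSpace ℕ (fun _ => Option (Fin N × Bool)) (fun _ => ⊥))

theorem tendsto_point_iff {N : ℕ} (u : ℕ → Compactification N) (Y : Boundary N) :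
    Tendsto u atTop (𝓝 (Compactification.point Y)) ↔
      ∀ i, ∀ᶠ n in atTop, (u n).letters i = some (Y.1 i) := by
  let _ : TopologicalSpace (Option (Fin N × Bool)) := ⊥
  have _ : DiscreteTopology (Option (Fin N × Bool)) := ⟨rfl⟩
  have h : IsInducing (Compactification.letters (N := N)) := ⟨rfl⟩
  rw [h.tendsto_nhds_iff, tendsto_pi_nhds]
  simp only [nhds_discrete, tendsto_pure]
  rfl

theorem toWord_pref {N : ℕ} (X : Boundary N) (n : ℕ) :
    (X.pref n).toWord = (List.range n).map X.1 := by
  rw [Boundary.pref, FreeGroup.toWord_mk]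
  apply FreeGroup.IsReduced.reduce_eq
  rw [FreeGroup.IsReduced, List.isChain_iff_getElem]
  intro i hi
  simpa using X.2 i

theorem toWord_mul_letter {N : ℕ} (g : FreeGroup (Fin N)) (l : Fin N × Bool) :
    (g * letter l).toWord = g.toWord ++ [l] ∨
      ∃ x, g.toWord = (g * letter l).toWord ++ [x] := by
  by_cases h : FreeGroup.IsReduced (g.toWord ++ [l])
  · left
    rw [letter, FreeGroup.toWord_mul, FreeGroup.toWord_mk, FreeGroup.reduce_singleton]
    exact h.reduce_eq
  · right
    have hg : FreeGroup.IsReduced g.toWord := FreeGroup.isReduced_toWord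
    rcases List.eq_nil_or_concat g.toWord with h0 | ⟨L, x, hL⟩
    · exact absurd (by rw [h0]; exact FreeGroup.IsReduced.singleton) h
    · simp only [List.concat_eq_append] at hL
      have hx : x.1 = l.1 ∧ x.2 = !l.2 := by
        by_contra hx
        apply h
        rw [hL] at hg ⊢
        rw [FreeGroup.IsReduced, List.append_assoc] at *
        rw [List.isChain_append] at hg ⊢
        refine ⟨hg.1, ?_, ?_⟩
        · simp only [List.cons_append, List.nil_append, List.isChain_pair]
          intro h1
          by_contra h2
          exact hx ⟨h1, by cases h3 : x.2 <;> cases h4 : l.2 <;> simp_all⟩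
        · simpa using hg.2.2
      refine ⟨x, ?_⟩
      have hLred : FreeGroup.IsReduced L := hg.infix (by rw [hL]; exact ⟨[], [x], by simp⟩)
      have : g * letter l = FreeGroup.mk L := by
        rw [← FreeGroup.mk_toWord (x := g), hL, letter, FreeGroup.mul_mk]
        apply Quot.sound
        have := @FreeGroup.Red.Step.not (Fin N) L [] l.1 (!l.2)
        obtain ⟨x1, x2⟩ := x
        obtain ⟨l1, l2⟩ := l
        simp only at hx
        obtain ⟨rfl, rfl⟩ := hx
        simpa using this
      rw [this, FreeGroup.toWord_mk, hLred.reduce_eq, hL]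

theorem take_toWord_mul {N : ℕ} (m : ℕ) (W : List (Fin N × Bool)) :
    ∀ g : FreeGroup (Fin N), m + W.length ≤ g.norm →
      (g * FreeGroup.mk W).toWord.take m = g.toWord.take m := by
  induction W with
  | nil => intro g _; simp [← FreeGroup.one_eq_mk]
  | cons l W ih =>
    intro g hg
    have e : g * FreeGroup.mk (l :: W) = (g * letter l) * FreeGroup.mk W := by
      rw [mul_assoc, letter, FreeGroup.mul_mk]; rfl
    simp only [List.length_cons, FreeGroup.norm] at hg
    rcases toWord_mul_letter g l with h | ⟨x, h⟩
    · rw [e, ih _ (by simp only [FreeGroup.norm]; rw [h]; simp; omega), h,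
        List.take_append_of_le_length (by omega)]
    · have hlen := congrArg List.length h
      simp only [List.length_append, List.length_singleton] at hlen
      rw [e, ih _ (by simp only [FreeGroup.norm]; omega), h,
        List.take_append_of_le_length (by omega)]

/-- An injective self-map of the free group that moves neighbours to elements at bounded distance
sends the prefixes of an infinite reduced word to a sequence converging to a boundary point. -/
theorem exists_tendsto {N : ℕ} (f : FreeGroup (Fin N) → FreeGroup (Fin N))
    (hf : Function.Injective f) (C : ℕ)
    (hC : ∀ g l, ((f g)⁻¹ * f (g * letter l)).norm ≤ C) (X : Boundary N) :
    ∃ Y : Boundary N,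
      Tendsto (fun n => Compactification.word (f (X.pref n))) atTop
        (𝓝 (Compactification.point Y)) := by
  have hpinj : Function.Injective X.pref := by
    intro a b hab
    have := congrArg (fun g => g.toWord.length) hab
    simpa [toWord_pref] using this
  have hstep : ∀ n, X.pref (n + 1) = X.pref n * letter (X.1 n) := by
    intro n
    simp [Boundary.pref, letter, FreeGroup.mul_mk, List.range_succ]
  have hfar : ∀ R : ℕ, ∀ᶠ n in atTop, R ≤ (f (X.pref n)).norm := by
    intro R
    have hfin : {g : FreeGroup (Fin N) | g.norm ≤ R}.Finite :=
      ((List.finite_length_le (Fin N × Bool) R).preimage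
        FreeGroup.toWord_injective.injOn)
    have := (hf.comp hpinj).tendsto_cofinite.eventually
      (hfin.compl_mem_cofinite)
    rw [Nat.cofinite_eq_atTop] at this
    filter_upwards [this] with n hn
    exact (not_le.1 hn).le
  have hex : ∀ m : ℕ, ∃ n₀, ∀ n ≥ n₀, m + C ≤ (f (X.pref n)).norm ∧
      (f (X.pref n)).toWord.take m = (f (X.pref n₀)).toWord.take m := by
    intro m
    obtain ⟨n₀, hn₀⟩ := eventually_atTop.1 (hfar (m + C))
    refine ⟨n₀, fun n hn => ⟨hn₀ n hn, ?_⟩⟩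
    induction n, hn using Nat.le_induction with
    | base => rfl
    | succ n hn ih =>
      rw [← ih]
      have h1 := hC (X.pref n) (X.1 n)
      rw [← hstep] at h1
      have h2 := take_toWord_mul m ((f (X.pref n))⁻¹ * f (X.pref (n + 1))).toWord
        (f (X.pref n)) (by
          have := hn₀ n hn
          simp only [FreeGroup.norm] at *
          omega)
      rwa [FreeGroup.mk_toWord, mul_inv_cancel_left] at h2
  choose n₀ hn₀ using hex
  have hlet : ∀ i : ℕ, ∃ l : Fin N × Bool, ∀ᶠ n in atTop, (f (X.pref n)).toWord[i]? = some l := by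
    intro i
    have hlen : i < (f (X.pref (n₀ (i + 1)))).toWord.length := by
      have := (hn₀ (i + 1) _ le_rfl).1
      simp only [FreeGroup.norm] at this
      omega
    refine ⟨(f (X.pref (n₀ (i + 1)))).toWord[i], ?_⟩
    filter_upwards [eventually_ge_atTop (n₀ (i + 1))] with n hn
    have h := congrArg (fun L : List (Fin N × Bool) => L[i]?) (hn₀ (i + 1) n hn).2
    simp only [List.getElem?_take, Nat.lt_succ_self, if_true] at h
    rw [h, List.getElem?_eq_getElem hlen]
  choose Y hY using hlet
  refine ⟨⟨Y, fun i => ?_⟩, (tendsto_point_iff _ _).2 hY⟩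
  obtain ⟨n, h1, h2⟩ := ((hY i).and (hY (i + 1))).exists
  have hr : FreeGroup.IsReduced (f (X.pref n)).toWord := FreeGroup.isReduced_toWord
  rw [FreeGroup.IsReduced, List.isChain_iff_getElem] at hr
  obtain ⟨a1, b1⟩ := List.getElem?_eq_some_iff.1 h1
  obtain ⟨a2, b2⟩ := List.getElem?_eq_some_iff.1 h2
  have := hr i a2
  rwa [b1, b2] at this

theorem exists_tendsto_aut {N : ℕ} (ψ : MulAut (FreeGroup (Fin N))) (X : Boundary N) :
    ∃ Y : Boundary N,
      Tendsto (fun n => Compactification.word (ψ (X.pref n))) atTop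
        (𝓝 (Compactification.point Y)) := by
  obtain ⟨C, hC⟩ := (Set.finite_range fun l : Fin N × Bool => (ψ (letter l)).norm).bddAbove
  refine exists_tendsto ψ ψ.injective C (fun g l => ?_) X
  rw [map_mul, inv_mul_cancel_left]
  exact hC ⟨l, rfl⟩

theorem exists_tendsto_mul {N : ℕ} (g : FreeGroup (Fin N)) (X : Boundary N) :
    ∃ Y : Boundary N,
      Tendsto (fun n => Compactification.word (g * X.pref n)) atTop
        (𝓝 (Compactification.point Y)) := by
  refine exists_tendsto (fun x => g * x) (mul_right_injective g) 1 (fun x l => ?_) X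
  rw [← mul_assoc, mul_inv_rev, mul_assoc, mul_assoc, inv_mul_cancel_left, inv_mul_cancel_left]
  exact FreeGroup.norm_mk_le

/-- The homeomorphism of the boundary induced by an automorphism `ψ`: the image of `X` is the limit
of the images under `ψ` of the prefixes of `X` (limits are unique). -/
def boundaryMap {N : ℕ} (ψ : MulAut (FreeGroup (Fin N))) (X : Boundary N) : Boundary N :=
  (exists_tendsto_aut ψ X).choose

/-- The action of the free group on its boundary by left translation: `g X` is the
limit of the products of `g` with the prefixes of `X`. -/
def translate {N : ℕ} (g : FreeGroup (Fin N)) (X : Boundary N) : Boundary N :=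
  (exists_tendsto_mul g X).choose

/-- The map induced by `ψ` on the compactification. -/
def compactMap {N : ℕ} (ψ : MulAut (FreeGroup (Fin N))) :
    Compactification N → Compactification N
  | .word g => .word (ψ g)
  | .point X => .point (boundaryMap ψ X)

/-! ### Attracting points -/

/-- A fixed point `x` of `f` is attracting if the `f`-orbit of every point in some neighbourhood of
`x` converges to `x`. -/
def IsAttractingPoint {T : Type*} [TopologicalSpace T] (f : T → T) (x : T) : Prop :=
  f x = x ∧ ∃ U ∈ 𝓝 x, ∀ y ∈ U, Tendsto (fun n : ℕ => f^[n] y) atTop (𝓝 x)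

/-- The set of attracting boundary points of `ψ`. The neighbourhoods are taken in the
compactification; hence a limit of words fixed by `ψ` is not attracting. -/
def attractingPoints {N : ℕ} (ψ : MulAut (FreeGroup (Fin N))) : Set (Boundary N) :=
  {X | IsAttractingPoint (compactMap ψ) (Compactification.point X)}

/-- A pair of boundary points is attracting for the map induced by `ψ` on pairs. Again
neighbourhoods are taken in the (product of two copies of the) compactification; in particular
the pair is attracting for the map induced on pairs of distinct boundary points. -/
def IsAttractingPair {N : ℕ} (ψ : MulAut (FreeGroup (Fin N))) (W : Boundary N × Boundary N) :
    Prop :=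
  IsAttractingPoint (Prod.map (compactMap ψ) (compactMap ψ))
    (Compactification.point W.1, Compactification.point W.2)

/-! ### Positive primitive automorphisms and the attracting subshift -/

/-- A nonempty word all of whose letters are basis elements. -/
def PurePositive {N : ℕ} (g : FreeGroup (Fin N)) : Prop :=
  g ≠ 1 ∧ ∀ l ∈ g.toWord, l.2 = true

/-- The image of each basis element is pure positive. -/
def IsPositiveAut {N : ℕ} (φ : MulAut (FreeGroup (Fin N))) : Prop :=
  ∀ a, PurePositive (φ (FreeGroup.of a))

/-- For some `k ≥ 1`, all basis elements are letters of `φ ^ k (a)` for each basis element `a`. -/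
def IsPrimitiveAut {N : ℕ} (φ : MulAut (FreeGroup (Fin N))) : Prop :=
  ∃ k : ℕ, 1 ≤ k ∧ ∀ a b, (b, true) ∈ ((φ ^ k) (FreeGroup.of a)).toWord

/-- The shift on pairs of boundary points: `(X, Y) ↦ (Y₀⁻¹ X, Y₀⁻¹ Y)`. -/
def shift {N : ℕ} (W : Boundary N × Boundary N) : Boundary N × Boundary N :=
  (translate (letter (W.2.1 0))⁻¹ W.1, translate (letter (W.2.1 0))⁻¹ W.2)

/-- The inverse of the shift on the pairs `(X, Y)` with `X₀ ≠ Y₀`: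
`(X, Y) ↦ (X₀⁻¹ X, X₀⁻¹ Y)`. -/
def shiftInv {N : ℕ} (W : Boundary N × Boundary N) : Boundary N × Boundary N :=
  (translate (letter (W.1.1 0))⁻¹ W.1, translate (letter (W.1.1 0))⁻¹ W.2)

/-- The two-sided orbit of a pair `(X, Y)` with `X₀ ≠ Y₀` under the shift. -/
def shiftOrbit {N : ℕ} (W : Boundary N × Boundary N) : Set (Boundary N × Boundary N) :=
  {Z | ∃ n : ℕ, Z = shift^[n] W ∨ Z = shiftInv^[n] W}

/-- `(X, Y)` is obtained from a basis element `a` and a cancellation free decomposition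
`φ ^ k (a) = p a s` with `p` and `s` pure positive as
`X = lim p⁻¹ φ^k(p⁻¹) φ^(2k)(p⁻¹) ⋯ φ^(nk)(p⁻¹)` and `Y = lim a s φ^k(s) φ^(2k)(s) ⋯ φ^(nk)(s)`. -/
def IsGeneratingPair {N : ℕ} (φ : MulAut (FreeGroup (Fin N))) (W : Boundary N × Boundary N) :
    Prop :=
  ∃ (a : Fin N) (k : ℕ) (p s : FreeGroup (Fin N)),
    1 ≤ k ∧ PurePositive p ∧ PurePositive s ∧ (φ ^ k) (FreeGroup.of a) = p * FreeGroup.of a * s ∧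
    Tendsto (fun n : ℕ => Compactification.word
      ((List.range (n + 1)).map fun j => (φ ^ (j * k)) p⁻¹).prod) atTop
      (𝓝 (Compactification.point W.1)) ∧
    Tendsto (fun n : ℕ => Compactification.word
      (FreeGroup.of a * ((List.range (n + 1)).map fun j => (φ ^ (j * k)) s).prod)) atTop
      (𝓝 (Compactification.point W.2))

/-- The attracting subshift of `φ`: the closure, in the space of pairs of distinct boundary points,
of the shift orbit of a generating pair. -/
def attractingSubshift {N : ℕ} (φ : MulAut (FreeGroup (Fin N))) : Set (Boundary N × Boundary N) :=
  {Z | Z.1 ≠ Z.2 ∧ ∃ W, IsGeneratingPair φ W ∧ Z ∈ closure (shiftOrbit W)}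

/-! ### Outer classes, isogredience and the index -/

/-- The conjugation `i_w : u ↦ w⁻¹ u w`. -/
def inner {N : ℕ} (w : FreeGroup (Fin N)) : MulAut (FreeGroup (Fin N)) := MulAut.conj w⁻¹

/-- The union over `k ≥ 1` of the outer classes of `φ ^ k`. -/
def outerClassUnion {N : ℕ} (φ : MulAut (FreeGroup (Fin N))) : Set (MulAut (FreeGroup (Fin N))) :=
  {ψ | ∃ (w : FreeGroup (Fin N)) (k : ℕ), 1 ≤ k ∧ ψ = inner w * φ ^ k}

/-- `χ = i_v ∘ ψ ∘ i_{v⁻¹}` for some `v`. -/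
def Isogredient {N : ℕ} (ψ χ : MulAut (FreeGroup (Fin N))) : Prop :=
  ∃ v, χ = inner v * ψ * inner v⁻¹

/-- The subgroup of elements fixed by `ψ`. -/
def fixedSubgroup {N : ℕ} (ψ : MulAut (FreeGroup (Fin N))) : Subgroup (FreeGroup (Fin N)) :=
  ψ.toMonoidHom.eqLocus (MonoidHom.id _)

/-- The rank of a subgroup: the least cardinality of a generating set (for a free group this is the
cardinality of a basis). -/
def subgroupRank {G : Type*} [Group G] (H : Subgroup G) : ℕ∞ :=
  ⨅ S : {S : Set G // Subgroup.closure S = H}, S.1.encard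

/-- The number of orbits of the fixed subgroup of `ψ` in the set of attracting points of `ψ`. -/
def attractingClassCount {N : ℕ} (ψ : MulAut (FreeGroup (Fin N))) : ℕ∞ :=
  {O : Set (Boundary N) | ∃ X ∈ attractingPoints ψ,
    O = {Y | ∃ u ∈ fixedSubgroup ψ, Y = translate u X}}.encard

/-- The index `rk(Fix ψ) + (a(ψ) - 2) / 2`. -/
def index {N : ℕ} (ψ : MulAut (FreeGroup (Fin N))) : EReal :=
  ((subgroupRank (fixedSubgroup ψ) : ENNReal) : EReal) +
    (((attractingClassCount ψ : ENNReal) : EReal) - 2) / 2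

end FreeBoundary

end

/-!
Let `F` be the free group of rank `N`, and let `ψ = i_w ∘ φ ^ k`. A power of `φ` is given by a
positive substitution `σ` for which every basis element occurs in the interior of every word `σ b`,
and for which passing to the first (last) letters of the words `σ b` is idempotent (`IsGood`,
`exists_isGood`). Some power `ψ ^ h` has the form `i_w ∘ Φ` with such a power `Φ` of `φ`. It acts on
the Cayley tree of `F` by the map `θ : g ↦ w⁻¹ * Φ g` (`lift`), which sends a positive edge labelled
`a` to a positive path labelled `σ a` and commutes with the left translations by the elements that
`ψ ^ h` fixes.

*Leaves.* If the image under `θ` of a positive edge runs over this edge (`Crosses`), then the images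
of the edge under the iterates of `θ` grow to a bi-infinite positive line that `θ` maps into itself
(`IsLeaf`, `Crosses.exists_leaf`). If `θ` fixes an endpoint of the edge, the edge has to be
prolonged beyond this endpoint before. The finite subwords of the line occur in iterates of `σ`, so
the pair of its ends, seen from any of its vertices, lies in the attracting subshift
(`IsLeaf.ends_mem_attractingSubshift`). Moreover `θ` expands the line, so for the conjugate of
`ψ ^ h` that has a given vertex of the line as base point, this pair is attracting
(`IsLeaf.isAttractingPair`). It remains to find two distinct leaves with a common vertex.

*Crossing edges.* If `θ` moves neither end of a geodesic inward, the geodesic contains a crossing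
edge (`exists_crosses`). When two distinct leaves are disjoint, this applies to the geodesic that
joins them, and the leaf through the crossing edge is closer to the first leaf than the second one
was. Hence the existence of two distinct leaves implies the existence of two distinct leaves with a
common vertex (`HasTwoLeaves.exists_common_vertex`).

*Positive index.* By bounded cancellation, an automorphism moves the long prefixes of an attracting
point outward (`growth_of_mem_attractingPoints`), and so does `θ`. There are three cases
(`cases_of_index_pos`). If there are three attracting points, then `θ` moves outward in three
disjoint cones of the tree. Two of the cones give a leaf, and a leaf misses one of the three cones,
so that a second leaf is found on the way to it (`hasTwoLeaves_of_three_cones`). If there are an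
attracting point and a nontrivial fixed element `u`, then `θ` moves a vertex `x` far out on the ray
outward, and `u * x` accordingly, so the geodesic from `x` to `u * x` contains a crossing edge
(`hasTwoLeaves_of_growth_of_fixed`). If there are two fixed elements that do not commute, the same
argument works with a vertex far out on the axis of one of them and its translate by the other
(`hasTwoLeaves_of_not_commute`). In the last two cases one leaf suffices, because a nontrivial fixed
element translates it to another one (`Crosses.hasTwoLeaves`).
-/

namespace FreeBoundary

variable {N : ℕ}

/-! ### Cones in the Cayley tree -/

/-- The first letter of the reduced word of `g`. -/
def hd (g : FreeGroup (Fin N)) : Option (Fin N × Bool) := g.toWord.head?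

/-- The inverse of a letter. -/
def linv (l : Fin N × Bool) : Fin N × Bool := (l.1, !l.2)

/-- The cone beyond the oriented edge from `u` to `u * letter l` of the Cayley tree: the vertices
that the removal of this edge separates from `u`. -/
def Cone (u : FreeGroup (Fin N)) (l : Fin N × Bool) (z : FreeGroup (Fin N)) : Prop :=
  hd (u⁻¹ * z) = some l

@[simp] theorem linv_linv (l : Fin N × Bool) : linv (linv l) = l := by simp [linv]

theorem letter_inv (l : Fin N × Bool) : (letter l)⁻¹ = letter (linv l) := by
  simp [letter, linv, FreeGroup.inv_mk, FreeGroup.invRev]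

theorem letter_mul_mk (l : Fin N × Bool) (W : List (Fin N × Bool)) :
    letter l * FreeGroup.mk W = FreeGroup.mk (l :: W) := by
  simp [letter, FreeGroup.mul_mk]

theorem mk_append (V W : List (Fin N × Bool)) :
    FreeGroup.mk (V ++ W) = FreeGroup.mk V * FreeGroup.mk W := by
  simp [FreeGroup.mul_mk]

theorem toWord_letter (l : Fin N × Bool) : (letter l).toWord = [l] := by
  simp [letter, FreeGroup.toWord_mk]

theorem toWord_mk_of_isReduced {W : List (Fin N × Bool)} (h : FreeGroup.IsReduced W) :
    (FreeGroup.mk W).toWord = W := by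
  rw [FreeGroup.toWord_mk, h.reduce_eq]

@[simp] theorem hd_one : hd (1 : FreeGroup (Fin N)) = none := by simp [hd]

@[simp] theorem hd_letter (l : Fin N × Bool) : hd (letter l) = some l := by
  simp [hd, toWord_letter]

theorem hd_eq_none {g : FreeGroup (Fin N)} : hd g = none ↔ g = 1 := by
  simp [hd, FreeGroup.toWord_eq_nil_iff]

theorem hd_letter_mul {l : Fin N × Bool} {g : FreeGroup (Fin N)} (h : hd g ≠ some (linv l)) :
    (letter l * g).toWord = l :: g.toWord := by
  have hr : FreeGroup.IsReduced (l :: g.toWord) := by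
    have hg : FreeGroup.IsReduced g.toWord := FreeGroup.isReduced_toWord
    rw [FreeGroup.IsReduced, List.isChain_cons]
    refine ⟨fun y hy h1 => ?_, hg⟩
    by_contra h2
    apply h
    rw [hd, Option.mem_def.1 hy, linv]
    congr 1
    ext
    · simp [h1]
    · cases h3 : y.2 <;> cases h4 : l.2 <;> simp_all
  rw [← toWord_mk_of_isReduced hr, ← letter_mul_mk, FreeGroup.mk_toWord]

theorem toWord_cons {g : FreeGroup (Fin N)} {l : Fin N × Bool} {t : List (Fin N × Bool)}
    (h : g.toWord = l :: t) :
    (letter l)⁻¹ * g = FreeGroup.mk t ∧ (FreeGroup.mk t).toWord = t ∧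
      hd (FreeGroup.mk t) ≠ some (linv l) := by
  have hg : FreeGroup.IsReduced (l :: t) := h ▸ FreeGroup.isReduced_toWord
  have ht : FreeGroup.IsReduced t := hg.infix ⟨[l], [], by simp⟩
  refine ⟨?_, toWord_mk_of_isReduced ht, ?_⟩
  · rw [← FreeGroup.mk_toWord (x := g), h, ← letter_mul_mk, inv_mul_cancel_left]
  · rw [hd, toWord_mk_of_isReduced ht]
    intro h1
    rw [FreeGroup.IsReduced, List.isChain_cons] at hg
    have := hg.1 (linv l) (by simpa using h1) rfl
    simp [linv] at this

theorem hd_eq_some_iff {g : FreeGroup (Fin N)} {l : Fin N × Bool} :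
    hd g = some l ↔ hd ((letter l)⁻¹ * g) ≠ some (linv l) := by
  constructor
  · intro h
    obtain ⟨t, ht⟩ : ∃ t, g.toWord = l :: t := by
      rw [hd, List.head?_eq_some_iff] at h; exact h
    obtain ⟨h1, -, h2⟩ := toWord_cons ht
    rwa [h1]
  · intro h
    have := hd_letter_mul h
    rw [mul_inv_cancel_left] at this
    simp [hd, this]

/-- The two cones of an edge are complementary. -/
theorem cone_iff_not_cone_linv {u z : FreeGroup (Fin N)} {l : Fin N × Bool} :
    Cone u l z ↔ ¬ Cone (u * letter l) (linv l) z := by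
  rw [Cone, Cone, hd_eq_some_iff, mul_inv_rev, mul_assoc]

theorem cone_mul_letter (u : FreeGroup (Fin N)) (l : Fin N × Bool) : Cone u l (u * letter l) := by
  simp [Cone]

/-- The only edge that leads into a cone is the one that defines it. -/
theorem eq_of_cone_mul_letter {u y : FreeGroup (Fin N)} {l l' : Fin N × Bool}
    (h : ¬ Cone u l y) (h' : Cone u l (y * letter l')) : y = u ∧ l' = l := by
  rw [Cone, ← mul_assoc] at h'
  rw [Cone] at h
  set g := u⁻¹ * y with hg
  rcases toWord_mul_letter g l' with h1 | ⟨x, h1⟩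
  · rw [hd, h1] at h'
    rw [hd] at h
    rcases h2 : g.toWord with _ | ⟨b, t⟩
    · rw [h2] at h'
      rw [FreeGroup.toWord_eq_nil_iff, hg, inv_mul_eq_one] at h2
      exact ⟨h2.symm, by simpa using h'⟩
    · rw [h2] at h h'
      exact absurd (by simpa using h') h
  · exfalso
    apply h
    rw [hd] at h' ⊢
    rw [h1]
    rcases h2 : (g * letter l').toWord with _ | ⟨b, t⟩
    · simp [h2] at h'
    · simpa [h2] using h'

theorem eq_of_not_cone_mul_letter {u y : FreeGroup (Fin N)} {l l' : Fin N × Bool}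
    (h : Cone u l y) (h' : ¬ Cone u l (y * letter l')) : y * letter l' = u ∧ l' = linv l := by
  have := eq_of_cone_mul_letter h' (l' := linv l') (by rwa [← letter_inv, mul_inv_cancel_right])
  refine ⟨this.1, ?_⟩
  rw [← this.2, linv_linv]

theorem cone_subset {u z : FreeGroup (Fin N)} {l l' : Fin N × Bool} (h : l' ≠ linv l)
    (hz : Cone (u * letter l) l' z) : Cone u l z := by
  rw [cone_iff_not_cone_linv, Cone]
  rw [Cone] at hz
  rw [hz]
  simpa using h

/-! ### Norms -/

/-- Cancellation in `a⁻¹ * b` only affects a common prefix. -/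
theorem norm_inv_mul_of_hd_ne {a b : FreeGroup (Fin N)} (h : hd a ≠ hd b) :
    (a⁻¹ * b).norm = a.norm + b.norm := by
  have key : ∀ (W : List (Fin N × Bool)) (b : FreeGroup (Fin N)), FreeGroup.IsReduced W →
      W.head? ≠ hd b → ((FreeGroup.mk W)⁻¹ * b).norm = W.length + b.norm := by
    intro W
    induction W with
    | nil => intro b _ _; simp [← FreeGroup.one_eq_mk]
    | cons l W ih =>
      intro b hW hb
      have h1 : hd b ≠ some (linv (linv l)) := by
        rw [linv_linv]; exact fun h => hb (by simp [h])
      have h2 := hd_letter_mul h1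
      have hW' : FreeGroup.IsReduced W := hW.infix ⟨[l], [], by simp⟩
      rw [← letter_mul_mk, mul_inv_rev, mul_assoc, letter_inv, ih _ hW' _]
      · simp [FreeGroup.norm, h2]; omega
      · rw [hd, h2]
        have h3 := (toWord_cons (toWord_mk_of_isReduced hW)).2.2
        rw [hd, toWord_mk_of_isReduced hW'] at h3
        simpa using h3
  have := key a.toWord b FreeGroup.isReduced_toWord h
  rwa [FreeGroup.mk_toWord] at this

theorem norm_mul_of_hd_ne {a b : FreeGroup (Fin N)} (h : hd a⁻¹ ≠ hd b) :
    (a * b).norm = a.norm + b.norm := by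
  have := norm_inv_mul_of_hd_ne h
  rwa [inv_inv, FreeGroup.norm_inv_eq] at this

theorem norm_letter (l : Fin N × Bool) : (letter l).norm = 1 := by
  simp [FreeGroup.norm, toWord_letter]

theorem norm_inv_mul_comm (a b : FreeGroup (Fin N)) : (a⁻¹ * b).norm = (b⁻¹ * a).norm := by
  rw [← FreeGroup.norm_inv_eq, mul_inv_rev, inv_inv]

theorem norm_inv_mul_le (a b c : FreeGroup (Fin N)) :
    (a⁻¹ * c).norm ≤ (a⁻¹ * b).norm + (b⁻¹ * c).norm := by
  have := FreeGroup.norm_mul_le (a⁻¹ * b) (b⁻¹ * c)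
  rwa [mul_assoc, mul_inv_cancel_left] at this

theorem norm_of_toWord_eq_append {g : FreeGroup (Fin N)} {V W : List (Fin N × Bool)}
    (h : g.toWord = V ++ W) : (FreeGroup.mk V).toWord = V ∧ (FreeGroup.mk W).toWord = W ∧
      g = FreeGroup.mk V * FreeGroup.mk W := by
  have hg : FreeGroup.IsReduced (V ++ W) := h ▸ FreeGroup.isReduced_toWord
  refine ⟨toWord_mk_of_isReduced (hg.infix ⟨[], W, by simp⟩),
    toWord_mk_of_isReduced (hg.infix ⟨V, [], by simp⟩), ?_⟩
  rw [← mk_append, ← h, FreeGroup.mk_toWord]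

/-- The word `R` is the longest common prefix of `L` and `M`; the second alternative is `L = M`. -/
theorem exists_common_prefix {α : Type*} (L M : List α) :
    ∃ R L' M', L = R ++ L' ∧ M = R ++ M' ∧ (L'.head? ≠ M'.head? ∨ (L' = [] ∧ M' = [])) := by
  classical
  induction L generalizing M with
  | nil =>
    rcases M with _ | ⟨m, M⟩
    · exact ⟨[], [], [], by simp⟩
    · exact ⟨[], [], m :: M, by simp⟩
  | cons l L ih =>
    rcases M with _ | ⟨m, M⟩
    · exact ⟨[], l :: L, [], by simp⟩
    · by_cases h : l = m
      · subst h
        obtain ⟨R, L', M', h1, h2, h3⟩ := ih M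
        exact ⟨l :: R, L', M', by simp [h1], by simp [h2], h3⟩
      · exact ⟨[], l :: L, m :: M, by simp [h]⟩

/-- The geodesics from `1` to `a` and to `b` share the path labelled by the longest common prefix
`R` and then part, so the distance from `a` to `b` is the total length of the two remainders. -/
theorem exists_longest_prefix (a b : FreeGroup (Fin N)) :
    ∃ R V W, a.toWord = R ++ V ∧ b.toWord = R ++ W ∧ (a⁻¹ * b).norm = V.length + W.length := by
  obtain ⟨R, V, W, h1, h2, h3⟩ := exists_common_prefix a.toWord b.toWord
  refine ⟨R, V, W, h1, h2, ?_⟩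
  obtain ⟨-, hV, ha⟩ := norm_of_toWord_eq_append h1
  obtain ⟨-, hW, hb⟩ := norm_of_toWord_eq_append h2
  rw [ha, hb, mul_inv_rev, mul_assoc, inv_mul_cancel_left]
  rcases h3 with h3 | ⟨rfl, rfl⟩
  · rw [norm_inv_mul_of_hd_ne (by rwa [hd, hd, hV, hW])]
    simp [FreeGroup.norm, hV, hW]
  · simp [← FreeGroup.one_eq_mk]

/-! ### Bounded cancellation -/

theorem exists_norm_map_le (ψ : MulAut (FreeGroup (Fin N))) :
    ∃ L : ℕ, ∀ g, (ψ g).norm ≤ L * g.norm := by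
  obtain ⟨L, hL⟩ := (Set.finite_range fun l : Fin N × Bool => (ψ (letter l)).norm).bddAbove
  refine ⟨L, fun g => ?_⟩
  have key : ∀ W : List (Fin N × Bool), (ψ (FreeGroup.mk W)).norm ≤ L * W.length := by
    intro W
    induction W with
    | nil => simp [← FreeGroup.one_eq_mk]
    | cons l W ih =>
      rw [← letter_mul_mk, map_mul]
      refine (FreeGroup.norm_mul_le _ _).trans ?_
      have : (ψ (letter l)).norm ≤ L := hL ⟨l, rfl⟩
      rw [List.length_cons, mul_add, mul_one]
      omega
  have := key g.toWord
  rwa [FreeGroup.mk_toWord] at this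

/-- A path in the Cayley tree whose image under a map `f` of the vertices enters a cone has an edge
at which the image enters. -/
theorem exists_enters_cone (f : FreeGroup (Fin N) → FreeGroup (Fin N)) {u : FreeGroup (Fin N)}
    {l : Fin N × Bool} (W : List (Fin N × Bool)) :
    ∀ y, ¬ Cone u l (f y) → Cone u l (f (y * FreeGroup.mk W)) →
    ∃ W₁ x W₂, W = W₁ ++ x :: W₂ ∧ ¬ Cone u l (f (y * FreeGroup.mk W₁)) ∧
      Cone u l (f (y * FreeGroup.mk W₁ * letter x)) := by
  induction W with
  | nil => intro y h1 h2; simp [← FreeGroup.one_eq_mk] at h2; exact absurd h2 h1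
  | cons x W ih =>
    intro y h1 h2
    by_cases h : Cone u l (f (y * letter x))
    · exact ⟨[], x, W, rfl, by simpa [← FreeGroup.one_eq_mk] using h1,
        by simpa [← FreeGroup.one_eq_mk] using h⟩
    · obtain ⟨W₁, x', W₂, e, h3, h4⟩ := ih _ h (by rwa [mul_assoc, letter_mul_mk])
      refine ⟨x :: W₁, x', W₂, by simp [e], ?_, ?_⟩
      · rwa [← letter_mul_mk, ← mul_assoc]
      · rwa [← letter_mul_mk, ← mul_assoc]

/-- Bounded cancellation: for a product `x * z` without cancellation, the cancellation in
`ψ x * ψ z` is at most a constant. The cancelled part ends at a vertex near the image of a prefix of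
`x⁻¹` and near the image of a prefix of `z`. These prefixes are close to each other because `ψ⁻¹` is
Lipschitz, hence both are short. -/
theorem exists_bounded_cancellation (ψ : MulAut (FreeGroup (Fin N))) :
    ∃ C : ℕ, ∀ x z : FreeGroup (Fin N), (x * z).norm = x.norm + z.norm →
      (ψ x).norm + (ψ z).norm ≤ (ψ (x * z)).norm + 2 * C := by
  obtain ⟨L, hL⟩ := exists_norm_map_le ψ
  obtain ⟨L', hL'⟩ := exists_norm_map_le ψ⁻¹
  -- a vertex `r` on the geodesic from `1` to `ψ a` is near the image of a prefix of `a`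
  have near : ∀ (a : FreeGroup (Fin N)) (R V : List (Fin N × Bool)), (ψ a).toWord = R ++ V →
      ∃ a₁ a₂, a = a₁ * a₂ ∧ a.norm = a₁.norm + a₂.norm ∧
        ((ψ a₁)⁻¹ * FreeGroup.mk R).norm ≤ L := by
    intro a R V h
    rcases List.eq_nil_or_concat R with rfl | ⟨R₀, l, hR⟩
    · exact ⟨1, a, by simp, by simp, by simp [← FreeGroup.one_eq_mk]⟩
    · rw [List.concat_eq_append] at hR
      have h' : (ψ a).toWord = R₀ ++ (l :: V) := by rw [h, hR]; simp
      obtain ⟨hw1, hw2, hw3⟩ := norm_of_toWord_eq_append h'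
      have hc1 : ¬ Cone (FreeGroup.mk R₀) l (ψ 1) := by
        have hred : FreeGroup.IsReduced (R₀ ++ [l]) := by
          have := (FreeGroup.isReduced_toWord (x := ψ a))
          rw [h, hR] at this
          exact this.infix ⟨[], V, by simp⟩
        rw [cone_iff_not_cone_linv, not_not, map_one, Cone, mul_one, letter, ← mk_append]
        rw [hd, FreeGroup.toWord_inv, toWord_mk_of_isReduced hred]
        simp [FreeGroup.invRev, linv]
      have hc2 : Cone (FreeGroup.mk R₀) l (ψ a) := by
        rw [hw3, Cone, inv_mul_cancel_left, hd, hw2]; rfl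
      obtain ⟨W₁, x, W₂, e, h3, h4⟩ := exists_enters_cone ψ a.toWord 1 hc1
        (by rwa [one_mul, FreeGroup.mk_toWord])
      rw [one_mul] at h3 h4
      obtain ⟨e1, e2, e3⟩ := norm_of_toWord_eq_append e
      refine ⟨FreeGroup.mk W₁, FreeGroup.mk (x :: W₂), e3, ?_, ?_⟩
      · simp only [FreeGroup.norm, e1, e2, e]; simp
      · have hne : hd ((FreeGroup.mk R₀)⁻¹ * ψ (FreeGroup.mk W₁)) ≠
            hd ((FreeGroup.mk R₀)⁻¹ * ψ (FreeGroup.mk W₁ * letter x)) := by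
          rw [Cone] at h3 h4; rw [h4]; exact h3
        have hn := norm_inv_mul_of_hd_ne hne
        have e4 : ((FreeGroup.mk R₀)⁻¹ * ψ (FreeGroup.mk W₁))⁻¹ *
            ((FreeGroup.mk R₀)⁻¹ * ψ (FreeGroup.mk W₁ * letter x)) = ψ (letter x) := by
          rw [map_mul]; group
        rw [e4] at hn
        have h5 : 1 ≤ ((FreeGroup.mk R₀)⁻¹ * ψ (FreeGroup.mk W₁ * letter x)).norm := by
          rw [Nat.one_le_iff_ne_zero, Ne, FreeGroup.norm_eq_zero, ← hd_eq_none]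
          rw [Cone] at h4; rw [h4]; simp
        have h6 := hL (letter x)
        rw [norm_letter, mul_one] at h6
        have h7 := FreeGroup.norm_mul_le ((ψ (FreeGroup.mk W₁))⁻¹ * FreeGroup.mk R₀) (letter l)
        rw [norm_letter, mul_assoc, letter, ← mk_append, ← hR,
          norm_inv_mul_comm _ (FreeGroup.mk R₀)] at h7
        omega
  refine ⟨L * (L' * (2 * L)) + L, fun x z hxz => ?_⟩
  obtain ⟨R, V, W, h1, h2, h3⟩ := exists_longest_prefix (ψ x⁻¹) (ψ z)
  have hR : R.length ≤ L * (L' * (2 * L)) + L := by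
    obtain ⟨a₁, a₂, ha, hna, ha'⟩ := near x⁻¹ R V h1
    obtain ⟨b₁, b₂, hb, hnb, hb'⟩ := near z R W h2
    have h4 : (ψ (a₁⁻¹ * b₁)).norm ≤ 2 * L := by
      have := norm_inv_mul_le (ψ a₁) (FreeGroup.mk R) (ψ b₁)
      rw [map_mul, map_inv]
      rw [norm_inv_mul_comm (FreeGroup.mk R)] at this
      omega
    have h5 : (a₁⁻¹ * b₁).norm ≤ L' * (2 * L) := by
      have := hL' (ψ (a₁⁻¹ * b₁))
      rw [MulAut.inv_apply_self] at this
      exact this.trans (Nat.mul_le_mul_left _ h4)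
    have h6 : a₁.norm ≤ (a₁⁻¹ * b₁).norm := by
      have e : x * z = (a₂⁻¹ * (a₁⁻¹ * b₁)) * b₂ := by
        rw [hb, ← inv_inv x, ha]; group
      have i1 := FreeGroup.norm_mul_le (a₂⁻¹ * (a₁⁻¹ * b₁)) b₂
      have i2 := FreeGroup.norm_mul_le a₂⁻¹ (a₁⁻¹ * b₁)
      rw [← e] at i1
      rw [FreeGroup.norm_inv_eq] at i2 hna
      omega
    have h7 := hL a₁
    have h8 : L * a₁.norm ≤ L * (L' * (2 * L)) := Nat.mul_le_mul_left _ (h6.trans h5)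
    have h9 := FreeGroup.norm_mul_le (ψ a₁) ((ψ a₁)⁻¹ * FreeGroup.mk R)
    rw [mul_inv_cancel_left] at h9
    have h10 : (FreeGroup.mk R).norm = R.length := by
      simp only [FreeGroup.norm, (norm_of_toWord_eq_append h1).1]
    omega
  have h4 : (ψ x).norm = R.length + V.length := by
    rw [← FreeGroup.norm_inv_eq, ← map_inv, FreeGroup.norm, h1, List.length_append]
  have h5 : (ψ z).norm = R.length + W.length := by
    rw [FreeGroup.norm, h2, List.length_append]
  rw [← map_inv, inv_inv, ← map_mul] at h3
  omega

/-! ### Neighbourhoods of boundary points -/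

/-- The first `j` letters of the finite or infinite word `z` are those of `X`. These sets form a
neighbourhood basis of `X` in the compactification. -/
def Follows (X : Boundary N) (j : ℕ) (z : Compactification N) : Prop :=
  ∀ i < j, z.letters i = some (X.1 i)

theorem Follows.mono {X : Boundary N} {j k : ℕ} {z : Compactification N} (h : Follows X k z)
    (hjk : j ≤ k) : Follows X j z :=
  fun i hi => h i (hi.trans_le hjk)

theorem Follows.le_norm {X : Boundary N} {j : ℕ} {g : FreeGroup (Fin N)}
    (h : Follows X j (.word g)) : j ≤ g.norm := by
  rcases Nat.eq_zero_or_pos j with rfl | hj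
  · exact Nat.zero_le _
  · have := h (j - 1) (by omega)
    obtain ⟨h1, -⟩ := List.getElem?_eq_some_iff.1 this
    rw [FreeGroup.norm]
    omega

theorem norm_pref (X : Boundary N) (n : ℕ) : (X.pref n).norm = n := by
  simp [FreeGroup.norm, toWord_pref]

theorem follows_pref (X : Boundary N) {j n : ℕ} (h : j ≤ n) : Follows X j (.word (X.pref n)) := by
  intro i hi
  simp [Compactification.letters, toWord_pref, List.getElem?_range (hi.trans_le h)]

theorem pref_succ (X : Boundary N) (n : ℕ) : X.pref (n + 1) = X.pref n * letter (X.1 n) := by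
  simp [Boundary.pref, letter, FreeGroup.mul_mk, List.range_succ]

theorem Follows.take_eq {X : Boundary N} {j : ℕ} {g : FreeGroup (Fin N)}
    (h : Follows X j (.word g)) : g.toWord.take j = (X.pref j).toWord := by
  rw [toWord_pref]
  apply List.ext_getElem?
  intro i
  rw [List.getElem?_take]
  split_ifs with hi
  · have h1 := h i hi
    rw [Compactification.letters] at h1
    simp [h1, List.getElem?_range hi]
  · simp [hi]

theorem Follows.toWord_inv_mul {X : Boundary N} {j : ℕ} {g : FreeGroup (Fin N)}
    (h : Follows X j (.word g)) : ((X.pref j)⁻¹ * g).toWord = g.toWord.drop j := by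
  obtain ⟨h1, h2, h3⟩ := norm_of_toWord_eq_append (List.take_append_drop j g.toWord).symm
  have h4 : (X.pref j) = FreeGroup.mk (g.toWord.take j) := by
    rw [h.take_eq, FreeGroup.mk_toWord]
  rw [h4]
  nth_rw 2 [h3]
  rw [inv_mul_cancel_left, h2]

theorem Follows.hd_inv_mul {X : Boundary N} {j : ℕ} {g : FreeGroup (Fin N)}
    (h : Follows X j (.word g)) :
    hd ((X.pref j)⁻¹ * g) = (Compactification.word g).letters j := by
  rw [hd, h.toWord_inv_mul, List.head?_drop, Compactification.letters]

theorem Follows.norm_inv_mul {X : Boundary N} {j : ℕ} {g : FreeGroup (Fin N)}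
    (h : Follows X j (.word g)) : ((X.pref j)⁻¹ * g).norm + j = g.norm := by
  have := h.le_norm
  rw [FreeGroup.norm, h.toWord_inv_mul, List.length_drop]
  rw [FreeGroup.norm] at *
  omega

theorem Follows.norm_inv_mul_add_le {X : Boundary N} {j : ℕ} {a b : FreeGroup (Fin N)}
    (ha : Follows X j (.word a)) (hb : Follows X j (.word b)) :
    (a⁻¹ * b).norm + 2 * j ≤ a.norm + b.norm := by
  have h1 := norm_inv_mul_le a (X.pref j) b
  rw [norm_inv_mul_comm a (X.pref j)] at h1
  have h2 := ha.norm_inv_mul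
  have h3 := hb.norm_inv_mul
  omega

/-- The hypothesis says that the common prefix of `a` and `b` has length at least `j`. -/
theorem Follows.of_norm_le {X : Boundary N} {j : ℕ} {a b : FreeGroup (Fin N)}
    (ha : Follows X j (.word a)) (h : (a⁻¹ * b).norm + 2 * j ≤ a.norm + b.norm) :
    Follows X j (.word b) := by
  obtain ⟨R, V, W, h1, h2, h3⟩ := exists_longest_prefix a b
  have hR : j ≤ R.length := by
    rw [h3] at h
    simp only [FreeGroup.norm, h1, h2, List.length_append] at h
    omega
  intro i hi
  rw [← ha i hi, Compactification.letters, Compactification.letters, h1, h2,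
    List.getElem?_append_left (by omega), List.getElem?_append_left (by omega)]

theorem Follows.mul {X : Boundary N} {j : ℕ} {g : FreeGroup (Fin N)} (y : FreeGroup (Fin N))
    (h : Follows X (j + y.norm) (.word g)) : Follows X j (.word (g * y)) := by
  refine (h.mono (Nat.le_add_right _ _)).of_norm_le ?_
  have h1 := h.le_norm
  have h2 := FreeGroup.norm_mul_le (g * y) y⁻¹
  rw [mul_inv_cancel_right, FreeGroup.norm_inv_eq] at h2
  rw [inv_mul_cancel_left]
  omega

theorem hd_inv_pref_succ (X : Boundary N) (m : ℕ) :
    hd (X.pref (m + 1))⁻¹ = some (linv (X.1 m)) := by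
  rw [hd, FreeGroup.toWord_inv, toWord_pref, List.range_succ]
  simp [FreeGroup.invRev, linv]

theorem follows_succ_iff_cone {X : Boundary N} {m : ℕ} {g : FreeGroup (Fin N)} :
    Follows X (m + 1) (.word g) ↔ Cone (X.pref m) (X.1 m) g := by
  constructor
  · intro h
    rw [Cone, (h.mono (Nat.le_succ m)).hd_inv_mul]
    exact h m (Nat.lt_succ_self m)
  · intro h
    have h0 : ¬ Cone (X.pref m) (X.1 m) 1 := by
      rw [cone_iff_not_cone_linv, not_not, ← pref_succ, Cone, mul_one, hd_inv_pref_succ]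
    have h1 : hd (X.pref m)⁻¹ ≠ hd ((X.pref m)⁻¹ * g) := by
      rw [Cone, mul_one] at h0
      rw [Cone] at h
      rwa [h]
    have h2 := norm_mul_of_hd_ne h1
    rw [mul_inv_cancel_left, norm_pref] at h2
    refine (follows_pref X le_rfl).of_norm_le ?_
    obtain ⟨t, ht⟩ : ∃ t, ((X.pref m)⁻¹ * g).toWord = X.1 m :: t := by
      rw [Cone, hd, List.head?_eq_some_iff] at h; exact h
    obtain ⟨h3, h4, -⟩ := toWord_cons ht
    rw [pref_succ, mul_inv_rev, mul_assoc, h3, ← pref_succ, norm_pref]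
    simp only [FreeGroup.norm] at *
    rw [h4]
    rw [ht, List.length_cons] at h2
    omega

theorem tendsto_point_iff_follows (u : ℕ → Compactification N) (X : Boundary N) :
    Tendsto u atTop (𝓝 (.point X)) ↔ ∀ j, ∀ᶠ n in atTop, Follows X j (u n) := by
  rw [tendsto_point_iff]
  constructor
  · intro h j
    exact (eventually_all_finite (Set.finite_lt_nat j)).2 fun i _ => h i
  · intro h i
    exact (h (i + 1)).mono fun n hn => hn i (Nat.lt_succ_self i)

theorem setOf_follows_mem_nhds (X : Boundary N) (j : ℕ) :
    {z | Follows X j z} ∈ 𝓝 (Compactification.point X) := by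
  let _ : TopologicalSpace (Option (Fin N × Bool)) := ⊥
  have _ : DiscreteTopology (Option (Fin N × Bool)) := ⟨rfl⟩
  have h : IsInducing (Compactification.letters (N := N)) := ⟨rfl⟩
  refine (eventually_all_finite (Set.finite_lt_nat j)).2 fun i _ => ?_
  have h1 : Continuous fun z : Compactification N => z.letters i :=
    (continuous_apply i).comp h.continuous
  exact h1.continuousAt.eventually (p := fun o => o = some (X.1 i)) (by
    rw [nhds_discrete]; exact rfl)

theorem boundaryMap_spec (ψ : MulAut (FreeGroup (Fin N))) (X : Boundary N) :
    Tendsto (fun n => Compactification.word (ψ (X.pref n))) atTop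
      (𝓝 (.point (boundaryMap ψ X))) :=
  (exists_tendsto_aut ψ X).choose_spec

theorem point_eq_of_tendsto {u : ℕ → Compactification N} {X Y : Boundary N}
    (hX : Tendsto u atTop (𝓝 (.point X))) (hY : Tendsto u atTop (𝓝 (.point Y))) : X = Y := by
  rw [tendsto_point_iff] at hX hY
  ext1
  funext i
  obtain ⟨n, h1, h2⟩ := ((hX i).and (hY i)).exists
  exact Option.some_injective _ (h1.symm.trans h2)

/-! ### Attracting points and growth -/

/-- The automorphism `ψ` pushes the prefixes of `X` outward along `X`: the image of a long prefix
of length `m` begins with a prefix of length `m + K`, for every `K`. -/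
def Growth (ψ : MulAut (FreeGroup (Fin N))) (X : Boundary N) : Prop :=
  ∀ K : ℕ, ∀ᶠ m in atTop, Follows X (m + K) (.word (ψ (X.pref m)))

/-- By bounded cancellation, growth along the prefixes of `X` extends to all words that share a long
prefix with `X`. -/
theorem Growth.eventually_follows {ψ : MulAut (FreeGroup (Fin N))} {X : Boundary N}
    (h : Growth ψ X) (K : ℕ) :
    ∀ᶠ m in atTop, ∀ g, Follows X m (.word g) → Follows X (m + K) (.word (ψ g)) := by
  obtain ⟨C, hC⟩ := exists_bounded_cancellation ψ
  filter_upwards [h (K + C)] with m hm g hg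
  refine (hm.mono (by omega)).of_norm_le ?_
  have h1 := hC (X.pref m) ((X.pref m)⁻¹ * g) (by
    have := hg.norm_inv_mul
    rw [mul_inv_cancel_left, norm_pref]
    omega)
  rw [mul_inv_cancel_left, map_mul, map_inv] at h1
  have h2 := hm.le_norm
  omega

theorem Growth.pow {ψ : MulAut (FreeGroup (Fin N))} {X : Boundary N} (h : Growth ψ X) {n : ℕ}
    (hn : 1 ≤ n) : Growth (ψ ^ n) X := by
  have key : ∀ K, ∀ᶠ m in atTop, ∀ g, Follows X m (.word g) →
      Follows X (m + K) (.word ((ψ ^ n) g)) := by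
    intro K
    induction n, hn using Nat.le_induction with
    | base => simpa using h.eventually_follows K
    | succ n hn ih =>
      filter_upwards [ih, h.eventually_follows K] with m h1 h2 g hg
      rw [pow_succ', MulAut.mul_apply]
      exact h2 _ ((h1 g hg).mono (Nat.le_add_right _ _))
  intro K
  filter_upwards [key K] with m hm
  exact hm _ (follows_pref X le_rfl)

theorem Growth.isAttractingPoint {ψ : MulAut (FreeGroup (Fin N))} {X : Boundary N}
    (h : Growth ψ X) : IsAttractingPoint (compactMap ψ) (Compactification.point X) := by
  have hfix : boundaryMap ψ X = X := by
    refine point_eq_of_tendsto (boundaryMap_spec ψ X) ?_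
    rw [tendsto_point_iff_follows]
    intro j
    filter_upwards [h 0, eventually_ge_atTop j] with m hm hj
    exact hm.mono hj
  refine ⟨congrArg Compactification.point hfix, ?_⟩
  obtain ⟨M, hM⟩ := eventually_atTop.1 (h.eventually_follows 1)
  have step : ∀ m ≥ M, ∀ z, Follows X m z → Follows X (m + 1) (compactMap ψ z) := by
    intro m hm z hz
    rcases z with g | Y
    · exact hM m hm g hz
    · have hY := (tendsto_point_iff_follows _ _).1 (boundaryMap_spec ψ Y) (m + 1)
      obtain ⟨n, hn, hmn⟩ := (hY.and (eventually_ge_atTop m)).exists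
      have h1 : Follows X m (.word (Y.pref n)) := by
        intro i hi
        rw [follows_pref Y hmn i hi]
        exact hz i hi
      have h2 := hM m hm _ h1
      intro i hi
      exact (hn i hi).symm.trans (h2 i hi)
  refine ⟨_, setOf_follows_mem_nhds X M, fun z hz => ?_⟩
  have iter : ∀ n, Follows X (M + n) ((compactMap ψ)^[n] z) := by
    intro n
    induction n with
    | zero => exact hz
    | succ n ih =>
      rw [Function.iterate_succ_apply']
      exact step _ (Nat.le_add_right _ _) _ ih
  rw [tendsto_point_iff_follows]
  intro j
  filter_upwards [eventually_ge_atTop j] with n hn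
  exact (iter n).mono (by omega)

/-- Pigeonhole principle for a sequence that infinitely often lies in a fixed ball. -/
theorem exists_frequently_eq {f : ℕ → FreeGroup (Fin N)} {D : ℕ}
    (h : ∃ᶠ m in atTop, (f m).norm ≤ D) : ∃ d, ∃ᶠ m in atTop, f m = d := by
  by_contra hc
  push Not at hc
  have hfin : {g : FreeGroup (Fin N) | g.norm ≤ D}.Finite :=
    (List.finite_length_le (Fin N × Bool) D).preimage FreeGroup.toWord_injective.injOn
  have := (eventually_all_finite hfin).2 fun d _ => hc d
  obtain ⟨m, h1, h2⟩ := (h.and_eventually this).exists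
  exact h2 _ h1 rfl

/-- Words that converge to an attracting point are not fixed, so the automorphism displaces the
prefixes of an attracting point by unbounded amounts. -/
theorem eventually_lt_displacement {ψ : MulAut (FreeGroup (Fin N))} {X : Boundary N}
    (h : X ∈ attractingPoints ψ) (D : ℕ) :
    ∀ᶠ m in atTop, D < ((X.pref m)⁻¹ * ψ (X.pref m)).norm := by
  by_contra hc
  obtain ⟨d, hd⟩ := exists_frequently_eq (f := fun m => (X.pref m)⁻¹ * ψ (X.pref m)) (D := D)
    ((not_eventually.1 hc).mono fun m hm => not_lt.1 hm)
  obtain ⟨-, U, hU, hUX⟩ := h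
  obtain ⟨m₀, hm₀⟩ := hd.exists
  have hconv : Tendsto (fun m => Compactification.word (X.pref m * (X.pref m₀)⁻¹)) atTop
      (𝓝 (.point X)) := by
    rw [tendsto_point_iff_follows]
    intro j
    filter_upwards [eventually_ge_atTop (j + m₀)] with m hm
    exact Follows.mul _ (by
      rw [FreeGroup.norm_inv_eq, norm_pref]
      exact follows_pref X hm)
  obtain ⟨m, hm, hmU⟩ := (hd.and_eventually (hconv.eventually hU)).exists
  set u := X.pref m * (X.pref m₀)⁻¹ with hu
  have hfix : compactMap ψ (.word u) = .word u := by
    rw [compactMap]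
    congr 1
    rw [hu, map_mul, map_inv, inv_mul_eq_iff_eq_mul.1 hm, inv_mul_eq_iff_eq_mul.1 hm₀]
    group
  have h1 := hUX _ hmU
  simp only [Function.iterate_fixed hfix] at h1
  obtain ⟨n, hn⟩ := ((tendsto_point_iff_follows _ _).1 h1 (u.norm + 1)).exists
  have := hn.le_norm
  omega

/-- At an attracting point the automorphism pushes the prefixes outward. By bounded cancellation the
images of the prefixes stay near the ray, so the large displacements go along the ray. Consecutive
prefixes have nearby images, hence the direction, outward or inward, is the same for all long
prefixes. If it were inward, no orbit of a word near `X` could converge to `X`. -/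
theorem growth_of_mem_attractingPoints {ψ : MulAut (FreeGroup (Fin N))} {X : Boundary N}
    (h : X ∈ attractingPoints ψ) : Growth ψ X := by
  obtain ⟨C, hC⟩ := exists_bounded_cancellation ψ
  obtain ⟨L, hL⟩ := exists_norm_map_le ψ
  have hconv : ∀ j, ∀ᶠ n in atTop, Follows X j (.word (ψ (X.pref n))) := by
    have h1 : boundaryMap ψ X = X := Compactification.point.inj h.1
    have h2 := boundaryMap_spec ψ X
    rw [h1] at h2
    exact (tendsto_point_iff_follows _ _).1 h2
  set k : ℕ → ℕ := fun m => (ψ (X.pref m)).norm with hk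
  -- up to `C`, the images of the prefixes lie on the ray to `X`
  have hray : ∀ m, Follows X (k m - C) (.word (ψ (X.pref m))) := by
    intro m
    rcases le_total (k m) C with hkC | hkC
    · intro i hi
      omega
    obtain ⟨n, hn, hmn⟩ := ((hconv (k m - C)).and (eventually_ge_atTop m)).exists
    refine hn.of_norm_le ?_
    have h1 := hC (X.pref m) ((X.pref m)⁻¹ * X.pref n) (by
      have := (follows_pref X hmn).norm_inv_mul
      rw [mul_inv_cancel_left, norm_pref X m]
      omega)
    rw [mul_inv_cancel_left, map_mul, map_inv, norm_inv_mul_comm] at h1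
    have h2 : (ψ (X.pref m)).norm = k m := rfl
    have h3 := hn.le_norm
    omega
  have hdich : ∀ D, ∀ᶠ m in atTop, m + D < k m ∨ k m + D < m + 2 * C := by
    intro D
    filter_upwards [eventually_lt_displacement h D] with m hm
    have h2 : (ψ (X.pref m)).norm = k m := rfl
    rcases le_total m (k m - C) with h1 | h1
    · have := (follows_pref X le_rfl).norm_inv_mul_add_le ((hray m).mono h1)
      rw [norm_pref] at this
      omega
    · have := (follows_pref X h1).norm_inv_mul_add_le (hray m)
      rw [norm_pref] at this
      omega
  have hstep : ∀ m, k (m + 1) ≤ k m + L := by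
    intro m
    have h1 := FreeGroup.norm_mul_le (ψ (X.pref m)) (ψ (letter (X.1 m)))
    have h2 := hL (letter (X.1 m))
    rw [norm_letter, mul_one] at h2
    rw [← map_mul, ← pref_succ] at h1
    exact h1.trans (Nat.add_le_add_left h2 _)
  obtain ⟨M, hM⟩ := eventually_atTop.1 (hdich (4 * C + L + 2))
  by_cases hin : ∃ m ≥ M, k m + (4 * C + L + 2) < m + 2 * C
  · -- the prefixes are pushed inward; then no orbit near `X` converges to `X`
    exfalso
    obtain ⟨m₀, hm₀, hin⟩ := hin
    have hin' : ∀ m ≥ m₀, k m + C < m := by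
      have : ∀ m ≥ m₀, k m + (4 * C + L + 2) < m + 2 * C := by
        intro m hm
        induction m, hm using Nat.le_induction with
        | base => exact hin
        | succ m hm ih =>
          have h1 := hstep m
          rcases hM (m + 1) (by omega) with h2 | h2 <;> omega
      intro m hm
      have := this m hm
      omega
    have hdec : ∀ z j, m₀ ≤ j → Follows X j (.word z) → ¬ Follows X (j + 1) (.word z) →
        ¬ Follows X j (.word (ψ z)) := by
      intro z j hj hz hz' hc
      obtain ⟨n, hn, hjn⟩ := ((hconv j).and (eventually_gt_atTop j)).exists
      have hne : hd ((X.pref j)⁻¹ * z) ≠ hd ((X.pref j)⁻¹ * X.pref n) := by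
        rw [(follows_pref X hjn.le).hd_inv_mul, follows_pref X (Nat.succ_le_of_lt hjn) j
          (Nat.lt_succ_self j)]
        rwa [follows_succ_iff_cone] at hz'
      have h1 := norm_inv_mul_of_hd_ne hne
      have e : ((X.pref j)⁻¹ * z)⁻¹ * ((X.pref j)⁻¹ * X.pref n) =
        (z⁻¹ * X.pref j) * ((X.pref j)⁻¹ * X.pref n) := by group
      rw [norm_inv_mul_comm (X.pref j) z, e] at h1
      have h2 := hC _ _ h1
      simp only [map_mul, map_inv] at h2
      have e2 : (ψ z)⁻¹ * ψ (X.pref j) * ((ψ (X.pref j))⁻¹ * ψ (X.pref n)) =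
        (ψ z)⁻¹ * ψ (X.pref n) := by group
      rw [e2] at h2
      have h3 := hc.norm_inv_mul_add_le hn
      have h4 := FreeGroup.norm_mul_le (ψ (X.pref j)) ((ψ (X.pref j))⁻¹ * ψ z)
      have h5 := FreeGroup.norm_mul_le (ψ (X.pref j)) ((ψ (X.pref j))⁻¹ * ψ (X.pref n))
      rw [mul_inv_cancel_left] at h4 h5
      rw [norm_inv_mul_comm (ψ (X.pref j)) (ψ z)] at h4
      have h6 := hin' j hj
      have h7 : (ψ (X.pref j)).norm = k j := rfl
      omega
    obtain ⟨-, U, hU, hUX⟩ := h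
    have hpref : Tendsto (fun m => Compactification.word (X.pref m)) atTop (𝓝 (.point X)) := by
      rw [tendsto_point_iff_follows]
      intro j
      filter_upwards [eventually_ge_atTop j] with m hm using follows_pref X hm
    obtain ⟨m₁, hm₁⟩ := (hpref.eventually hU).exists
    have horb := (tendsto_point_iff_follows _ _).1 (hUX _ hm₁)
    have hit : ∀ n, ∃ z, (compactMap ψ)^[n] (.word (X.pref m₁)) = .word z := by
      intro n
      induction n with
      | zero => exact ⟨_, rfl⟩
      | succ n ih =>
        obtain ⟨z, hz⟩ := ih
        rw [Function.iterate_succ_apply', hz]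
        exact ⟨_, rfl⟩
    choose z hz using hit
    have hzs : ∀ n, z (n + 1) = ψ (z n) := by
      intro n
      have := hz (n + 1)
      rw [Function.iterate_succ_apply', hz n] at this
      exact (Compactification.word.inj this).symm
    simp only [hz] at horb
    obtain ⟨n₀, hn₀⟩ := eventually_atTop.1 (horb m₀)
    have hstay : ∀ n ≥ n₀, ¬ Follows X ((z n₀).norm + 1) (.word (z n)) := by
      intro n hn
      induction n, hn using Nat.le_induction with
      | base => intro hc; have := hc.le_norm; omega
      | succ n hn ih =>
        classical
        have hex : ∃ j, ¬ Follows X (j + 1) (.word (z n)) := ⟨_, ih⟩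
        have h1 := Nat.find_spec hex
        have h2 : Nat.find hex ≤ (z n₀).norm := Nat.find_min' hex ih
        have h3 : Follows X (Nat.find hex) (.word (z n)) := by
          rcases h4 : Nat.find hex with _ | j
          · intro i hi; omega
          · exact not_not.1 (Nat.find_min hex (m := j) (by omega))
        have h4 : m₀ ≤ Nat.find hex := by
          by_contra h5
          exact h1 ((hn₀ n hn).mono (by omega))
        rw [hzs]
        exact fun hc => hdec _ _ h4 h3 h1 (hc.mono (by omega))
    obtain ⟨n, h1, h2⟩ := ((horb ((z n₀).norm + 1)).and (eventually_ge_atTop n₀)).exists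
    exact hstay n h2 h1
  · push Not at hin
    intro K
    filter_upwards [hdich (K + C), eventually_ge_atTop M] with m h1 h2
    refine (hray m).mono ?_
    have h3 := hin m h2
    rcases hM m h2 with h4 | h4 <;> omega

/-! ### Positive words and substitutions -/

/-- The element of the free group given by a word in the basis elements. -/
def pos (L : List (Fin N)) : FreeGroup (Fin N) := FreeGroup.mk (L.map fun a => (a, true))

@[simp] theorem pos_nil : pos ([] : List (Fin N)) = 1 := rfl

theorem pos_append (L M : List (Fin N)) : pos (L ++ M) = pos L * pos M := by
  simp [pos, FreeGroup.mul_mk]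

theorem pos_singleton (a : Fin N) : pos [a] = FreeGroup.of a := rfl

theorem pos_cons (a : Fin N) (L : List (Fin N)) : pos (a :: L) = FreeGroup.of a * pos L :=
  pos_append [a] L

theorem letter_true (a : Fin N) : letter (a, true) = FreeGroup.of a := rfl

theorem letter_false (a : Fin N) : letter (a, false) = (FreeGroup.of a)⁻¹ := rfl

theorem toWord_pos (L : List (Fin N)) : (pos L).toWord = L.map fun a => (a, true) := by
  refine toWord_mk_of_isReduced ?_
  rw [FreeGroup.IsReduced, List.isChain_iff_getElem]
  intro i hi
  simp

theorem pos_injective : Function.Injective (pos : List (Fin N) → FreeGroup (Fin N)) := by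
  intro L M h
  have := congrArg FreeGroup.toWord h
  rw [toWord_pos, toWord_pos] at this
  exact List.map_injective_iff.2 (fun a b h => congrArg Prod.fst h) this

theorem purePositive_pos {L : List (Fin N)} (h : L ≠ []) : PurePositive (pos L) := by
  refine ⟨fun h1 => h (pos_injective h1), ?_⟩
  rw [toWord_pos]
  simp

theorem PurePositive.exists_eq_pos {g : FreeGroup (Fin N)} (h : PurePositive g) :
    pos (g.toWord.map Prod.fst) = g ∧ g.toWord.map Prod.fst ≠ [] := by
  refine ⟨?_, by simpa [FreeGroup.toWord_eq_nil_iff] using h.1⟩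
  rw [pos, List.map_map]
  conv_rhs => rw [← FreeGroup.mk_toWord (x := g)]
  congr 1
  conv_rhs => rw [← List.map_id g.toWord]
  refine List.map_congr_left fun l hl => ?_
  ext
  · rfl
  · simp [h.2 l hl]

/-- The image of a basis element under a positive automorphism, as a word in the basis. -/
def sub (φ : MulAut (FreeGroup (Fin N))) (a : Fin N) : List (Fin N) :=
  (φ (FreeGroup.of a)).toWord.map Prod.fst

theorem map_pos {φ : MulAut (FreeGroup (Fin N))} {σ : Fin N → List (Fin N)}
    (h : ∀ a, φ (FreeGroup.of a) = pos (σ a)) (L : List (Fin N)) :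
    φ (pos L) = pos (L.flatMap σ) := by
  induction L with
  | nil => simp
  | cons a L ih => rw [pos_cons, map_mul, h, ih, List.flatMap_cons, pos_append]

theorem IsPositiveAut.map_of {φ : MulAut (FreeGroup (Fin N))} (h : IsPositiveAut φ) (a : Fin N) :
    φ (FreeGroup.of a) = pos (sub φ a) :=
  (h a).exists_eq_pos.1.symm

theorem IsPositiveAut.sub_ne_nil {φ : MulAut (FreeGroup (Fin N))} (h : IsPositiveAut φ)
    (a : Fin N) : sub φ a ≠ [] :=
  (h a).exists_eq_pos.2

theorem IsPositiveAut.sub_mul {φ χ : MulAut (FreeGroup (Fin N))} (hφ : IsPositiveAut φ)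
    (hχ : IsPositiveAut χ) (a : Fin N) : sub (φ * χ) a = (sub χ a).flatMap (sub φ) := by
  rw [sub, MulAut.mul_apply, hχ.map_of, map_pos hφ.map_of, toWord_pos, List.map_map]
  exact List.map_id _

theorem IsPositiveAut.mul {φ χ : MulAut (FreeGroup (Fin N))} (hφ : IsPositiveAut φ)
    (hχ : IsPositiveAut χ) : IsPositiveAut (φ * χ) := by
  intro a
  rw [MulAut.mul_apply, hχ.map_of, map_pos hφ.map_of]
  refine purePositive_pos fun h => ?_
  obtain ⟨b, hb⟩ := List.exists_mem_of_ne_nil _ (hχ.sub_ne_nil a)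
  exact hφ.sub_ne_nil b (List.flatMap_eq_nil_iff.1 h b hb)

theorem IsPositiveAut.pow {φ : MulAut (FreeGroup (Fin N))} (hφ : IsPositiveAut φ) (n : ℕ) :
    IsPositiveAut (φ ^ n) := by
  induction n with
  | zero => exact fun a => purePositive_pos (L := [a]) (by simp)
  | succ n ih => rw [pow_succ]; exact ih.mul hφ

/-- The first letter of the image of a basis element. -/
def firstLetter (φ : MulAut (FreeGroup (Fin N))) (a : Fin N) : Fin N := (sub φ a).headD a

/-- The last letter of the image of a basis element. -/
def lastLetter (φ : MulAut (FreeGroup (Fin N))) (a : Fin N) : Fin N := (sub φ a).getLastD a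

theorem IsPositiveAut.sub_eq_cons {φ : MulAut (FreeGroup (Fin N))} (h : IsPositiveAut φ)
    (a : Fin N) : ∃ V, sub φ a = firstLetter φ a :: V := by
  rw [firstLetter]
  rcases h1 : sub φ a with _ | ⟨b, V⟩
  · exact absurd h1 (h.sub_ne_nil a)
  · exact ⟨V, rfl⟩

theorem IsPositiveAut.sub_eq_concat {φ : MulAut (FreeGroup (Fin N))} (h : IsPositiveAut φ)
    (a : Fin N) : ∃ U, sub φ a = U ++ [lastLetter φ a] := by
  rw [lastLetter]
  rcases List.eq_nil_or_concat (sub φ a) with h1 | ⟨U, b, h1⟩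
  · exact absurd h1 (h.sub_ne_nil a)
  · exact ⟨U, by simp [h1]⟩

theorem IsPositiveAut.firstLetter_mul {φ χ : MulAut (FreeGroup (Fin N))} (hφ : IsPositiveAut φ)
    (hχ : IsPositiveAut χ) (a : Fin N) :
    firstLetter (φ * χ) a = firstLetter φ (firstLetter χ a) := by
  obtain ⟨V, hV⟩ := hχ.sub_eq_cons a
  obtain ⟨U, hU⟩ := hφ.sub_eq_cons (firstLetter χ a)
  rw [firstLetter, hφ.sub_mul hχ, hV, List.flatMap_cons, hU]
  rfl

theorem IsPositiveAut.lastLetter_mul {φ χ : MulAut (FreeGroup (Fin N))} (hφ : IsPositiveAut φ)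
    (hχ : IsPositiveAut χ) (a : Fin N) :
    lastLetter (φ * χ) a = lastLetter φ (lastLetter χ a) := by
  obtain ⟨V, hV⟩ := hχ.sub_eq_concat a
  obtain ⟨U, hU⟩ := hφ.sub_eq_concat (lastLetter χ a)
  rw [lastLetter, hφ.sub_mul hχ, hV, List.flatMap_append, List.flatMap_singleton, hU]
  simp

theorem IsPositiveAut.firstLetter_pow {φ : MulAut (FreeGroup (Fin N))} (hφ : IsPositiveAut φ)
    (n : ℕ) : firstLetter (φ ^ n) = (firstLetter φ)^[n] := by
  induction n with
  | zero => funext a; simp [firstLetter, sub]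
  | succ n ih =>
    funext a
    rw [pow_succ, (hφ.pow n).firstLetter_mul hφ, ih, Function.iterate_succ_apply]

theorem IsPositiveAut.lastLetter_pow {φ : MulAut (FreeGroup (Fin N))} (hφ : IsPositiveAut φ)
    (n : ℕ) : lastLetter (φ ^ n) = (lastLetter φ)^[n] := by
  induction n with
  | zero => funext a; simp [lastLetter, sub]
  | succ n ih =>
    funext a
    rw [pow_succ, (hφ.pow n).lastLetter_mul hφ, ih, Function.iterate_succ_apply]

/-- All iterates of a self-map of a finite set whose exponent is a positive multiple of a suitable
`M` are idempotent. -/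
theorem exists_iterate_idempotent {α : Type*} [Finite α] (f : α → α) :
    ∃ M, 1 ≤ M ∧ ∀ t, 1 ≤ t → ∀ x, f^[M * t] (f^[M * t] x) = f^[M * t] x := by
  obtain ⟨i, j, hij, h⟩ : ∃ i j, i < j ∧ f^[i] = f^[j] := by
    obtain ⟨i, j, hne, h⟩ := Finite.exists_ne_map_eq_of_infinite fun n : ℕ => f^[n]
    rcases lt_or_gt_of_ne hne with h1 | h1
    · exact ⟨i, j, h1, h⟩
    · exact ⟨j, i, h1, h.symm⟩
  obtain ⟨d, rfl⟩ := Nat.exists_eq_add_of_lt hij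
  have per : ∀ q m, i ≤ m → f^[m + (d + 1) * q] = f^[m] := by
    intro q
    induction q with
    | zero => intro m _; rfl
    | succ q ih =>
      intro m hm
      obtain ⟨e, rfl⟩ := Nat.exists_eq_add_of_le hm
      rw [show i + e + (d + 1) * (q + 1) = (e + (d + 1) * q) + (i + d + 1) by ring,
        Function.iterate_add, ← h, ← Function.iterate_add, ← ih _ hm]
      congr 1
      ring
  refine ⟨(d + 1) * (i + 1), Nat.mul_pos (by omega) (by omega), fun t ht x => ?_⟩
  have := congrFun (per ((i + 1) * t) ((d + 1) * (i + 1) * t) (by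
    calc i ≤ 1 * (i + 1) * 1 := by omega
      _ ≤ _ := by gcongr; omega)) x
  rwa [← mul_assoc, Function.iterate_add_apply] at this

/-- The properties of a high power `Φ` of a positive primitive automorphism that are used below:
`Φ` is given by a substitution `σ`, every basis element occurs in the interior of every `σ b`, and
taking first (last) letters of the images of basis elements is idempotent. -/
structure IsGood (Φ : MulAut (FreeGroup (Fin N))) (σ : Fin N → List (Fin N)) : Prop where
  map_of : ∀ a, Φ (FreeGroup.of a) = pos (σ a)
  mid : ∀ a b, ∃ U V, U ≠ [] ∧ V ≠ [] ∧ σ b = U ++ a :: V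
  first : ∀ a b V, σ a = b :: V → ∃ V', σ b = b :: V'
  last : ∀ a b U, σ a = U ++ [b] → ∃ U', σ b = U' ++ [b]

theorem IsGood.three_le {Φ : MulAut (FreeGroup (Fin N))} {σ : Fin N → List (Fin N)}
    (h : IsGood Φ σ) (a : Fin N) : 3 ≤ (σ a).length := by
  obtain ⟨U, V, hU, hV, e⟩ := h.mid a a
  have := List.length_pos_iff.2 hU
  have := List.length_pos_iff.2 hV
  rw [e, List.length_append, List.length_cons]
  omega

/-- The power `φ ^ h` is good, and so are all its positive powers. -/
theorem exists_isGood (hN : 2 ≤ N) {φ : MulAut (FreeGroup (Fin N))} (hpos : IsPositiveAut φ)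
    (hprim : IsPrimitiveAut φ) : ∃ h, 1 ≤ h ∧ ∀ t, 1 ≤ t → ∃ σ, IsGood (φ ^ (h * t)) σ := by
  obtain ⟨k, hk, hfull⟩ := hprim
  have hmem : ∀ a b, b ∈ sub (φ ^ k) a := by
    intro a b
    exact List.mem_map.2 ⟨_, hfull a b, rfl⟩
  have hfull' : ∀ n a b, b ∈ sub (φ ^ (k * (n + 1))) a := by
    intro n a b
    rw [mul_add, mul_one, add_comm, pow_add, (hpos.pow _).sub_mul (hpos.pow _)]
    obtain ⟨c, hc⟩ := List.exists_mem_of_ne_nil _ ((hpos.pow (k * n)).sub_ne_nil a)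
    exact List.mem_flatMap.2 ⟨c, hc, hmem c b⟩
  have hlen : ∀ a, 2 ≤ (sub (φ ^ k) a).length := by
    intro a
    have h1 := hmem a ⟨0, by omega⟩
    have h2 := hmem a ⟨1, by omega⟩
    rcases h3 : sub (φ ^ k) a with _ | ⟨x, _ | ⟨y, l⟩⟩
    · simp [h3] at h1
    · rw [h3, List.mem_singleton] at h1 h2
      have := h1.trans h2.symm
      simp at this
    · simp
  have hlen2 : ∀ a, 4 ≤ (sub (φ ^ k * φ ^ k) a).length := by
    intro a
    rw [(hpos.pow _).sub_mul (hpos.pow _)]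
    have h2 := hlen a
    rcases h3 : sub (φ ^ k) a with _ | ⟨x, _ | ⟨y, l⟩⟩
    · simp [h3] at h2
    · simp [h3] at h2
    · have := hlen x
      have := hlen y
      simp only [List.flatMap_cons, List.length_append]
      omega
  have hmid : ∀ n a b, ∃ U V, U ≠ [] ∧ V ≠ [] ∧ sub (φ ^ (k * (n + 3))) b = U ++ a :: V := by
    intro n a b
    have e : k * (n + 3) = k * (n + 1) + (k + k) := by ring
    rw [e, pow_add, pow_add, (hpos.pow _).sub_mul ((hpos.pow _).mul (hpos.pow _))]
    have h2 := hlen2 b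
    rcases h3 : sub (φ ^ k * φ ^ k) b with _ | ⟨x, _ | ⟨y, _ | ⟨z, l⟩⟩⟩
    · simp [h3] at h2
    · simp [h3] at h2
    · simp [h3] at h2
    · obtain ⟨U, V, hUV⟩ := List.append_of_mem (hfull' n y a)
      refine ⟨sub (φ ^ (k * (n + 1))) x ++ U,
        V ++ (sub (φ ^ (k * (n + 1))) z ++ l.flatMap (sub (φ ^ (k * (n + 1))))), ?_, ?_, ?_⟩
      · simp [(hpos.pow _).sub_ne_nil]
      · simp [(hpos.pow _).sub_ne_nil]
      · simp [List.flatMap_cons, hUV]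
  obtain ⟨M₁, hM₁, h₁⟩ := exists_iterate_idempotent (firstLetter φ)
  obtain ⟨M₂, hM₂, h₂⟩ := exists_iterate_idempotent (lastLetter φ)
  refine ⟨k * 3 * (M₁ * M₂), Nat.mul_pos (by omega) (Nat.mul_pos hM₁ hM₂), fun t ht =>
    ⟨sub (φ ^ (k * 3 * (M₁ * M₂) * t)), ?_⟩⟩
  have hp := hpos.pow (k * 3 * (M₁ * M₂) * t)
  refine ⟨hp.map_of, ?_, ?_, ?_⟩
  · obtain ⟨r, hr⟩ : ∃ r, M₁ * M₂ * t = r + 1 :=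
      Nat.exists_eq_succ_of_ne_zero (by positivity)
    rw [show k * 3 * (M₁ * M₂) * t = k * (3 * r + 3) by rw [mul_assoc, hr]; ring]
    exact hmid _
  · intro a b V hV
    have e : firstLetter (φ ^ (k * 3 * (M₁ * M₂) * t)) a = b := by rw [firstLetter, hV]; rfl
    obtain ⟨V', hV'⟩ := hp.sub_eq_cons b
    refine ⟨V', ?_⟩
    have h3 := h₁ (k * 3 * M₂ * t) (by
      have : 0 < k * 3 * M₂ * t := by positivity
      omega) a
    rw [show M₁ * (k * 3 * M₂ * t) = k * 3 * (M₁ * M₂) * t by ring, ← hpos.firstLetter_pow, e]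
      at h3
    rwa [h3] at hV'
  · intro a b U hU
    have e : lastLetter (φ ^ (k * 3 * (M₁ * M₂) * t)) a = b := by rw [lastLetter, hU]; simp
    obtain ⟨U', hU'⟩ := hp.sub_eq_concat b
    refine ⟨U', ?_⟩
    have h3 := h₂ (k * 3 * M₁ * t) (by
      have : 0 < k * 3 * M₁ * t := by positivity
      omega) a
    rw [show M₂ * (k * 3 * M₁ * t) = k * 3 * (M₁ * M₂) * t by ring, ← hpos.lastLetter_pow, e]
      at h3
    rwa [h3] at hU'

/-! ### Crossing edges -/

/-- The map on the vertices of the Cayley tree that is the lift, for the automorphism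
`ψ = inner w * Φ`, of the map of the rose given by `Φ`: it sends `u * g` to `ψ u * lift w Φ g`. The
edge from `g` to `g * a` is sent to the path labelled by the word `Φ a`. -/
def lift (w : FreeGroup (Fin N)) (Φ : MulAut (FreeGroup (Fin N))) (g : FreeGroup (Fin N)) :
    FreeGroup (Fin N) :=
  w⁻¹ * Φ g

theorem lift_mul (w : FreeGroup (Fin N)) (Φ : MulAut (FreeGroup (Fin N)))
    (g h : FreeGroup (Fin N)) : lift w Φ (g * h) = lift w Φ g * Φ h := by
  rw [lift, lift, map_mul, mul_assoc]

theorem inner_mul_apply (w : FreeGroup (Fin N)) (Φ : MulAut (FreeGroup (Fin N)))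
    (g : FreeGroup (Fin N)) : (inner w * Φ) g = lift w Φ g * w := by
  simp [inner, lift, MulAut.mul_apply]

theorem lift_mul_of_fixed {w : FreeGroup (Fin N)} {Φ : MulAut (FreeGroup (Fin N))}
    {u : FreeGroup (Fin N)} (hu : (inner w * Φ) u = u) (g : FreeGroup (Fin N)) :
    lift w Φ (u * g) = u * lift w Φ g := by
  rw [inner_mul_apply] at hu
  rw [lift_mul]
  nth_rw 2 [← hu]
  simp only [lift]
  group

/-- The edge from `v` to `v * a` is crossing: its image under the lift, a path labelled `σ a`, runs
over this edge. -/
def Crosses (w : FreeGroup (Fin N)) (Φ : MulAut (FreeGroup (Fin N))) (σ : Fin N → List (Fin N))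
    (v : FreeGroup (Fin N)) (a : Fin N) : Prop :=
  ∃ p s, σ a = p ++ a :: s ∧ lift w Φ v * pos p = v

theorem crosses_of_cone {w : FreeGroup (Fin N)} {Φ : MulAut (FreeGroup (Fin N))}
    {σ : Fin N → List (Fin N)} (hΦ : ∀ a, Φ (FreeGroup.of a) = pos (σ a)) {v : FreeGroup (Fin N)}
    {a : Fin N} (h1 : ¬ Cone v (a, true) (lift w Φ v))
    (h2 : Cone v (a, true) (lift w Φ (v * FreeGroup.of a))) : Crosses w Φ σ v a := by
  rw [lift_mul, hΦ, pos] at h2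
  obtain ⟨W₁, x, W₂, e, h3, h4⟩ := exists_enters_cone id _ _ h1 h2
  obtain ⟨h5, rfl⟩ := eq_of_cone_mul_letter h3 h4
  obtain ⟨p, t, e1, rfl, e2⟩ := List.map_eq_append_iff.1 e
  obtain ⟨b, s, rfl, e3, e4⟩ := List.map_eq_cons_iff.1 e2
  have e5 : b = a := congrArg Prod.fst e3
  exact ⟨p, s, by rw [e1, e5], h5⟩

theorem Crosses.mul_left {w : FreeGroup (Fin N)} {Φ : MulAut (FreeGroup (Fin N))}
    {σ : Fin N → List (Fin N)} {v : FreeGroup (Fin N)} {a : Fin N} (h : Crosses w Φ σ v a)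
    {u : FreeGroup (Fin N)} (hu : (inner w * Φ) u = u) : Crosses w Φ σ (u * v) a := by
  obtain ⟨p, s, h1, h2⟩ := h
  exact ⟨p, s, h1, by rw [lift_mul_of_fixed hu, mul_assoc, h2]⟩

theorem hd_inv (g : FreeGroup (Fin N)) : hd g⁻¹ = g.toWord.getLast?.map linv := by
  rw [hd, FreeGroup.toWord_inv, FreeGroup.invRev, List.head?_reverse, List.getLast?_map]
  rfl

/-- If a map moves neither end of a reduced path inward, some edge of the path has an image that
crosses this edge in the direction of the path. -/
theorem exists_crossing_edge (f : FreeGroup (Fin N) → FreeGroup (Fin N))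
    (W : List (Fin N × Bool)) : ∀ (l : Fin N × Bool) (g : FreeGroup (Fin N)),
    FreeGroup.IsReduced (l :: W) → ¬ Cone g l (f g) →
    (∀ x, (l :: W).getLast? = some x →
      ¬ Cone (g * FreeGroup.mk (l :: W)) (linv x) (f (g * FreeGroup.mk (l :: W)))) →
    ∃ W₁ x W₂, l :: W = W₁ ++ x :: W₂ ∧ ¬ Cone (g * FreeGroup.mk W₁) x (f (g * FreeGroup.mk W₁)) ∧
      Cone (g * FreeGroup.mk W₁) x (f (g * FreeGroup.mk W₁ * letter x)) := by
  induction W with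
  | nil =>
    intro l g _ h1 h2
    refine ⟨[], l, [], rfl, by simpa [← FreeGroup.one_eq_mk] using h1, ?_⟩
    rw [cone_iff_not_cone_linv]
    simpa [← FreeGroup.one_eq_mk, letter] using h2 l rfl
  | cons l' W ih =>
    intro l g hr h1 h2
    by_cases h : Cone g l (f (g * letter l))
    · exact ⟨[], l, l' :: W, rfl, by simpa [← FreeGroup.one_eq_mk] using h1,
        by simpa [← FreeGroup.one_eq_mk] using h⟩
    · have hne : l' ≠ linv l := by
        rintro rfl
        rw [FreeGroup.IsReduced, List.isChain_cons] at hr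
        have := hr.1 (linv l) (by simp) rfl
        simp [linv] at this
      have e : ∀ V, g * FreeGroup.mk (l :: V) = g * letter l * FreeGroup.mk V := by
        intro V
        rw [mul_assoc, letter_mul_mk]
      obtain ⟨W₁, x, W₂, h3, h4, h5⟩ := ih l' (g * letter l) (hr.infix ⟨[l], [], by simp⟩)
        (fun hc => h (cone_subset hne hc)) (fun x hx => by
          rw [← e]
          exact h2 x (by simpa using hx))
      refine ⟨l :: W₁, x, W₂, by rw [h3]; rfl, ?_, ?_⟩
      · rwa [e]
      · rwa [e]

/-- If the lift moves neither of two vertices `g`, `h` towards the other, then the geodesic between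
them contains a crossing edge. -/
theorem exists_crosses {w : FreeGroup (Fin N)} {Φ : MulAut (FreeGroup (Fin N))}
    {σ : Fin N → List (Fin N)} (hΦ : ∀ a, Φ (FreeGroup.of a) = pos (σ a)) {g h : FreeGroup (Fin N)}
    (hgh : g ≠ h) (h1 : hd (g⁻¹ * lift w Φ g) ≠ hd (g⁻¹ * h))
    (h2 : hd (h⁻¹ * lift w Φ h) ≠ hd (h⁻¹ * g)) :
    ∃ W₁ l W₂ v a, (g⁻¹ * h).toWord = W₁ ++ l :: W₂ ∧ Crosses w Φ σ v a ∧
      ((v = g * FreeGroup.mk W₁ ∧ v * FreeGroup.of a = g * FreeGroup.mk W₁ * letter l) ∨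
        (v * FreeGroup.of a = g * FreeGroup.mk W₁ ∧ v = g * FreeGroup.mk W₁ * letter l)) := by
  rcases hW : (g⁻¹ * h).toWord with _ | ⟨l, W⟩
  · rw [FreeGroup.toWord_eq_nil_iff, inv_mul_eq_one] at hW
    exact absurd hW hgh
  · have e : g * FreeGroup.mk (l :: W) = h := by
      rw [← hW, FreeGroup.mk_toWord, mul_inv_cancel_left]
    obtain ⟨W₁, ⟨a, b⟩, W₂, h3, h4, h5⟩ := exists_crossing_edge (lift w Φ) W l g
      (hW ▸ FreeGroup.isReduced_toWord)
      (by
        intro hc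
        rw [Cone] at hc
        rw [hc] at h1
        apply h1
        rw [hd, hW]
        rfl)
      (by
        intro x hx hc
        rw [e, Cone] at hc
        apply h2
        have e1 : h⁻¹ * g = (g⁻¹ * h)⁻¹ := by group
        rw [hc, e1, hd_inv, hW, hx]
        rfl)
    cases b
    · refine ⟨W₁, (a, false), W₂, g * FreeGroup.mk W₁ * letter (a, false), a, h3, ?_, Or.inr ?_⟩
      · rw [cone_iff_not_cone_linv, not_not] at h4
        rw [cone_iff_not_cone_linv] at h5
        refine crosses_of_cone hΦ h5 ?_
        rw [letter_false, inv_mul_cancel_right]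
        exact h4
      · rw [letter_false, inv_mul_cancel_right]
        exact ⟨rfl, rfl⟩
    · exact ⟨W₁, (a, true), W₂, g * FreeGroup.mk W₁, a, h3, crosses_of_cone hΦ h4 h5,
        Or.inl ⟨rfl, rfl⟩⟩

/-! ### Heights -/

/-- The exponent sum of `g`, that is, the height of the vertex `g` in the Cayley tree when the
positive edges point upward. -/
def height (g : FreeGroup (Fin N)) : ℤ :=
  (FreeGroup.lift (fun _ : Fin N => Multiplicative.ofAdd (1 : ℤ)) g).toAdd

theorem height_mul (g h : FreeGroup (Fin N)) : height (g * h) = height g + height h := by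
  simp [height]

theorem height_of (a : Fin N) : height (FreeGroup.of a) = 1 := by simp [height]

theorem height_pos (L : List (Fin N)) : height (pos L) = L.length := by
  induction L with
  | nil => simp [height]
  | cons a L ih => rw [pos_cons, height_mul, height_of, ih, List.length_cons]; push_cast; ring

/-! ### Leaves -/

/-- The iterates of a substitution. -/
def wordIter (σ : Fin N → List (Fin N)) (n : ℕ) (L : List (Fin N)) : List (Fin N) :=
  (fun M : List (Fin N) => M.flatMap σ)^[n] L

theorem wordIter_succ (σ : Fin N → List (Fin N)) (n : ℕ) (L : List (Fin N)) :
    wordIter σ (n + 1) L = (wordIter σ n L).flatMap σ :=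
  Function.iterate_succ_apply' _ _ _

theorem wordIter_succ' (σ : Fin N → List (Fin N)) (n : ℕ) (L : List (Fin N)) :
    wordIter σ (n + 1) L = wordIter σ n (L.flatMap σ) :=
  Function.iterate_succ_apply _ _ _

theorem wordIter_add (σ : Fin N → List (Fin N)) (m n : ℕ) (L : List (Fin N)) :
    wordIter σ (m + n) L = wordIter σ m (wordIter σ n L) :=
  Function.iterate_add_apply _ _ _ _

theorem wordIter_append (σ : Fin N → List (Fin N)) (n : ℕ) (L M : List (Fin N)) :
    wordIter σ n (L ++ M) = wordIter σ n L ++ wordIter σ n M := by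
  induction n with
  | zero => rfl
  | succ n ih => rw [wordIter_succ, wordIter_succ, wordIter_succ, ih, List.flatMap_append]

theorem wordIter_ne_nil {σ : Fin N → List (Fin N)} (hσ : ∀ a, σ a ≠ []) (n : ℕ)
    {L : List (Fin N)} (hL : L ≠ []) : wordIter σ n L ≠ [] := by
  induction n with
  | zero => exact hL
  | succ n ih =>
    rw [wordIter_succ]
    intro h
    obtain ⟨b, hb⟩ := List.exists_mem_of_ne_nil _ ih
    exact hσ b (List.flatMap_eq_nil_iff.1 h b hb)

theorem map_iterate_lift {w : FreeGroup (Fin N)} {Φ : MulAut (FreeGroup (Fin N))}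
    {σ : Fin N → List (Fin N)} (hΦ : ∀ a, Φ (FreeGroup.of a) = pos (σ a)) (n : ℕ)
    (g : FreeGroup (Fin N)) (L : List (Fin N)) :
    (lift w Φ)^[n] (g * pos L) = (lift w Φ)^[n] g * pos (wordIter σ n L) := by
  induction n with
  | zero => rfl
  | succ n ih =>
    rw [Function.iterate_succ_apply', ih, lift_mul, map_pos hΦ, Function.iterate_succ_apply',
      wordIter_succ]

/-- A leaf of the attracting lamination that is invariant under the lift: a bi-infinite line in the
Cayley tree with vertices `pt i` and positive edges labelled `ω i` that is mapped into itself by the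
lift and all of whose finite subwords occur in iterates of the substitution on basis elements. -/
structure IsLeaf (w : FreeGroup (Fin N)) (Φ : MulAut (FreeGroup (Fin N)))
    (σ : Fin N → List (Fin N)) (ω : ℤ → Fin N) (pt : ℤ → FreeGroup (Fin N)) : Prop where
  step : ∀ i, pt (i + 1) = pt i * FreeGroup.of (ω i)
  inv : ∀ i, ∃ j, lift w Φ (pt i) = pt j
  lang : ∀ R : ℕ, ∃ (m : ℕ) (b : Fin N) (k : ℤ), ∀ i : ℤ, -(R : ℤ) ≤ i → i < R →
    0 ≤ i + k ∧ (wordIter σ m [b])[(i + k).toNat]? = some (ω i)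

/-- A positive path `c` starting at `g` whose image under the lift extends it at both ends generates
a line that contains it, the union of the images `pt (-A n), …, pt (B n)` of `c` under the iterates
of the lift. -/
theorem exists_line_of_seed {w : FreeGroup (Fin N)} {Φ : MulAut (FreeGroup (Fin N))}
    {σ : Fin N → List (Fin N)} (hΦ : ∀ a, Φ (FreeGroup.of a) = pos (σ a)) (hσ : ∀ a, σ a ≠ [])
    {g : FreeGroup (Fin N)} {p c s : List (Fin N)} (hp : p ≠ []) (hs : s ≠ [])
    (hc : c.flatMap σ = p ++ c ++ s) (hg : lift w Φ g * pos p = g) :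
    ∃ (ω : ℤ → Fin N) (pt : ℤ → FreeGroup (Fin N)) (A B : ℕ → ℕ),
      A 0 = 0 ∧ (∀ n, n ≤ A n) ∧ (∀ n, n ≤ B n) ∧ (∀ n, (wordIter σ n c).length = A n + B n) ∧
      (∀ (n : ℕ) (i : ℤ), 0 ≤ i + A n → i ≤ B n →
        pt i = (lift w Φ)^[n] g * pos ((wordIter σ n c).take (i + A n).toNat)) ∧
      (∀ (n : ℕ) (i : ℤ), 0 ≤ i + A n → i < B n →
        (wordIter σ n c)[(i + A n).toNat]? = some (ω i)) := by
  have hsucc : ∀ n, wordIter σ (n + 1) c =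
      wordIter σ n p ++ (wordIter σ n c ++ wordIter σ n s) := by
    intro n
    rw [wordIter_succ', hc, wordIter_append, wordIter_append, List.append_assoc]
  set A : ℕ → ℕ := fun n => ∑ k ∈ Finset.range n, (wordIter σ k p).length with hA
  set B : ℕ → ℕ := fun n => c.length + ∑ k ∈ Finset.range n, (wordIter σ k s).length with hB
  have hA1 : ∀ n, A (n + 1) = A n + (wordIter σ n p).length := fun n => Finset.sum_range_succ _ _
  have hB1 : ∀ n, B (n + 1) = B n + (wordIter σ n s).length := by
    intro n
    simp only [hB, Finset.sum_range_succ]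
    omega
  have hpn : ∀ n, 1 ≤ (wordIter σ n p).length :=
    fun n => List.length_pos_iff.2 (wordIter_ne_nil hσ n hp)
  have hsn : ∀ n, 1 ≤ (wordIter σ n s).length :=
    fun n => List.length_pos_iff.2 (wordIter_ne_nil hσ n hs)
  have hAn : ∀ n, n ≤ A n := by
    intro n
    induction n with
    | zero => exact Nat.zero_le _
    | succ n ih => have := hA1 n; have := hpn n; omega
  have hBn : ∀ n, n ≤ B n := by
    intro n
    induction n with
    | zero => exact Nat.zero_le _
    | succ n ih => have := hB1 n; have := hsn n; omega
  have hlen : ∀ n, (wordIter σ n c).length = A n + B n := by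
    intro n
    induction n with
    | zero => simp [wordIter, hA, hB]
    | succ n ih =>
      rw [hsucc, hA1, hB1, List.length_append, List.length_append, ih]
      omega
  have hbase : ∀ n, (lift w Φ)^[n + 1] g * pos (wordIter σ n p) = (lift w Φ)^[n] g := by
    intro n
    rw [Function.iterate_succ_apply, ← map_iterate_lift hΦ, hg]
  set E : ℕ → ℤ → FreeGroup (Fin N) := fun n i =>
    (lift w Φ)^[n] g * pos ((wordIter σ n c).take (i + A n).toNat) with hE
  have hidx : ∀ n (i : ℤ), 0 ≤ i + A n →
      (i + (A (n + 1) : ℕ)).toNat = (wordIter σ n p).length + (i + A n).toNat := by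
    intro n i h
    rw [hA1]
    omega
  have hE1 : ∀ n (i : ℤ), 0 ≤ i + A n → i ≤ B n → E (n + 1) i = E n i := by
    intro n i h1 h2
    have h3 := hlen n
    simp only [hE]
    rw [hidx n i h1, hsucc, List.take_length_add_append, pos_append, ← mul_assoc, hbase,
      List.take_append_of_le_length (by omega)]
  have hG1 : ∀ n (i : ℤ), 0 ≤ i + A n → i < B n →
      (wordIter σ (n + 1) c)[(i + (A (n + 1) : ℕ)).toNat]? =
        (wordIter σ n c)[(i + A n).toNat]? := by
    intro n i h1 h2
    have h3 := hlen n
    rw [hidx n i h1, hsucc, List.getElem?_append_right (by omega), Nat.add_sub_cancel_left,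
      List.getElem?_append_left (by omega)]
  have hmonoA : Monotone A := monotone_nat_of_le_succ fun n => by rw [hA1]; omega
  have hmonoB : Monotone B := monotone_nat_of_le_succ fun n => by rw [hB1]; omega
  have hE2 : ∀ n m (i : ℤ), n ≤ m → 0 ≤ i + A n → i ≤ B n → E m i = E n i := by
    intro n m i hnm h1 h2
    induction m, hnm using Nat.le_induction with
    | base => rfl
    | succ m hm ih =>
      have := hmonoA hm
      have := hmonoB hm
      rw [hE1 m i (by omega) (by omega), ih]
  have hG2 : ∀ n m (i : ℤ), n ≤ m → 0 ≤ i + A n → i < B n →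
      (wordIter σ m c)[(i + A m).toNat]? = (wordIter σ n c)[(i + A n).toNat]? := by
    intro n m i hnm h1 h2
    induction m, hnm using Nat.le_induction with
    | base => rfl
    | succ m hm ih =>
      have := hmonoA hm
      have := hmonoB hm
      rw [hG1 m i (by omega) (by omega), ih]
  have hex : ∀ i : ℤ, ∃ b,
      (wordIter σ (i.natAbs + 1) c)[(i + A (i.natAbs + 1)).toNat]? = some b := by
    intro i
    have h1 := hAn (i.natAbs + 1)
    have h2 := hBn (i.natAbs + 1)
    have h3 := hlen (i.natAbs + 1)
    exact ⟨_, List.getElem?_eq_getElem (by omega)⟩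
  choose ω hω using hex
  refine ⟨ω, fun i => E (i.natAbs + 1) i, A, B, by simp [hA], hAn, hBn, hlen, ?_, ?_⟩
  · intro n i h1 h2
    have h3 := hAn (i.natAbs + 1)
    have h4 := hBn (i.natAbs + 1)
    show E (i.natAbs + 1) i = E n i
    rcases le_total (i.natAbs + 1) n with h | h
    · exact (hE2 _ _ i h (by omega) (by omega)).symm
    · exact hE2 _ _ i h h1 h2
  · intro n i h1 h2
    have h3 := hAn (i.natAbs + 1)
    have h4 := hBn (i.natAbs + 1)
    rw [← hω i]
    rcases le_total (i.natAbs + 1) n with h | h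
    · exact hG2 _ _ i h (by omega) (by omega)
    · exact (hG2 _ _ i h h1 h2).symm

/-- The line generated by a path labelled by a subword of an iterate of the substitution on a basis
element is a leaf. -/
theorem exists_leaf_of_seed {w : FreeGroup (Fin N)} {Φ : MulAut (FreeGroup (Fin N))}
    {σ : Fin N → List (Fin N)} (hΦ : ∀ a, Φ (FreeGroup.of a) = pos (σ a)) (hσ : ∀ a, σ a ≠ [])
    {g : FreeGroup (Fin N)} {p c s : List (Fin N)} (hp : p ≠ []) (hs : s ≠ [])
    (hc : c.flatMap σ = p ++ c ++ s) (hg : lift w Φ g * pos p = g) {m : ℕ} {b : Fin N}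
    (hcb : c <:+: wordIter σ m [b]) :
    ∃ (ω : ℤ → Fin N) (pt : ℤ → FreeGroup (Fin N)) (A B : ℕ → ℕ), IsLeaf w Φ σ ω pt ∧
      (∀ n, n ≤ A n) ∧ (∀ n, n ≤ B n) ∧
      (∀ n, pt (-(A n : ℤ)) = (lift w Φ)^[n] g) ∧
      (∀ n, pt (B n) = (lift w Φ)^[n] (g * pos c)) ∧
      (∀ i : ℕ, i ≤ c.length → pt i = g * pos (c.take i)) ∧
      (∀ n (j : ℕ), j < (wordIter σ n c).length →
        (wordIter σ n c)[j]? = some (ω (j - A n))) := by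
  obtain ⟨ω, pt, A, B, hA0, hA, hB, hlen, hpt, hω⟩ := exists_line_of_seed hΦ hσ hp hs hc hg
  refine ⟨ω, pt, A, B, ⟨?_, ?_, ?_⟩, hA, hB, ?_, ?_, ?_, ?_⟩
  · intro i
    obtain ⟨n, hn⟩ : ∃ n, n = i.natAbs + 2 := ⟨_, rfl⟩
    have h1 := hA n
    have h2 := hB n
    have h3 := hlen n
    have h4 := hω n i (by omega) (by omega)
    rw [hpt n i (by omega) (by omega), hpt n (i + 1) (by omega) (by omega), mul_assoc,
      ← pos_singleton, ← pos_append,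
      show (i + 1 + (A n : ℤ)).toNat = (i + A n).toNat + 1 by omega, List.take_add_one, h4]
    rfl
  · intro i
    obtain ⟨n, hn⟩ : ∃ n, n = i.natAbs + 1 := ⟨_, rfl⟩
    have h1 := hA n
    have h2 := hB n
    have hpre : ((wordIter σ n c).take (i + A n).toNat).flatMap σ <+: wordIter σ (n + 1) c := by
      rw [wordIter_succ]
      conv_rhs => rw [← List.take_append_drop (i + A n).toNat (wordIter σ n c)]
      rw [List.flatMap_append]
      exact List.prefix_append _ _
    have h3 := hpre.length_le
    rw [hlen] at h3
    set k := (((wordIter σ n c).take (i + A n).toNat).flatMap σ).length with hk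
    refine ⟨k - A (n + 1), ?_⟩
    rw [hpt n i (by omega) (by omega), hpt (n + 1) (k - A (n + 1)) (by omega) (by omega), lift_mul,
      map_pos hΦ, Function.iterate_succ_apply',
      show ((k : ℤ) - A (n + 1) + A (n + 1)).toNat = k by omega,
      ← List.prefix_iff_eq_take.1 hpre]
  · intro R
    obtain ⟨U, V, hUV⟩ := hcb
    have h1 := hA R
    have h2 := hB R
    have h3 := hlen R
    refine ⟨R + m, b, (wordIter σ R U).length + A R, fun i hi1 hi2 => ⟨by omega, ?_⟩⟩
    rw [wordIter_add, ← hUV, wordIter_append, wordIter_append, List.append_assoc,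
      show (i + (((wordIter σ R U).length : ℤ) + A R)).toNat =
        (wordIter σ R U).length + (i + A R).toNat by omega,
      List.getElem?_append_right (by omega), Nat.add_sub_cancel_left,
      List.getElem?_append_left (by omega)]
    exact hω R i (by omega) (by omega)
  · intro n
    rw [hpt n _ (by omega) (by omega)]
    simp
  · intro n
    have h := hlen n
    rw [hpt n _ (by omega) (by omega), map_iterate_lift hΦ, List.take_of_length_le (by omega)]
  · intro i hi
    have h := hlen 0
    have h' : wordIter σ 0 c = c := rfl
    rw [h'] at h
    rw [hpt 0 i (by omega) (by omega), hA0, h']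
    simp
  · intro n j hj
    have h := hlen n
    have := hω n (j - A n) (by omega) (by omega)
    rwa [show ((j : ℤ) - A n + A n).toNat = j by omega] at this

namespace IsLeaf

variable {w : FreeGroup (Fin N)} {Φ : MulAut (FreeGroup (Fin N))} {σ : Fin N → List (Fin N)}
  {ω : ℤ → Fin N} {pt : ℤ → FreeGroup (Fin N)}

theorem height_pt (h : IsLeaf w Φ σ ω pt) (i : ℤ) : height (pt i) = height (pt 0) + i := by
  induction i using Int.induction_on with
  | zero => simp
  | succ i ih => rw [h.step, height_mul, height_of, ih]; ring
  | pred i ih =>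
    have := h.step (-i - 1)
    rw [sub_add_cancel] at this
    rw [this, height_mul, height_of] at ih
    linarith

/-- The lift expands leaves. -/
theorem strictMono_height_sub (h : IsLeaf w Φ σ ω pt) (hG : IsGood Φ σ) :
    StrictMono fun i => height (lift w Φ (pt i)) - height (pt i) := by
  refine strictMono_int_of_lt_succ fun i => ?_
  have := hG.three_le (ω i)
  rw [h.step, lift_mul, height_mul, height_mul, height_of, hG.map_of, height_pos]
  omega

end IsLeaf

/-- Every crossing edge lies on a leaf. If the lift fixes neither endpoint, the images of the edge
under the iterates of the lift exhaust the leaf. If it fixes the initial vertex, then `σ a` begins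
with `a`, and the edge is first prolonged backward by the last letter `b` of `σ b₁`, where `b₁`
precedes an occurrence of `a` in `σ a`: the word `b a` occurs in `σ (σ a)`, and `σ b` ends with `b`.
A fixed terminal vertex is treated in the same way. -/
theorem Crosses.exists_leaf {w : FreeGroup (Fin N)} {Φ : MulAut (FreeGroup (Fin N))}
    {σ : Fin N → List (Fin N)} (hG : IsGood Φ σ) {v : FreeGroup (Fin N)} {a : Fin N}
    (h : Crosses w Φ σ v a) :
    ∃ ω pt, IsLeaf w Φ σ ω pt ∧ v ∈ Set.range pt ∧ v * FreeGroup.of a ∈ Set.range pt := by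
  have hσ : ∀ a, σ a ≠ [] := fun a h => by have := hG.three_le a; simp [h] at this
  obtain ⟨p, s, h1, h2⟩ := h
  have hlen := hG.three_le a
  rw [h1, List.length_append, List.length_cons] at hlen
  obtain ⟨U, V, hU, hV, e⟩ := hG.mid a a
  rcases eq_or_ne p [] with rfl | hp
  · obtain ⟨U₁, b₁, rfl⟩ := (List.eq_nil_or_concat U).resolve_left hU
    obtain ⟨U₂, b, e2⟩ := (List.eq_nil_or_concat (σ b₁)).resolve_left (hσ b₁)
    rw [List.concat_eq_append] at e e2
    obtain ⟨q, hq⟩ := hG.last _ _ _ e2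
    have hq0 : q ≠ [] := by
      rintro rfl
      have := hG.three_le b
      simp [hq] at this
    have hs0 : s ≠ [] := by
      rintro rfl
      simp at hlen
    rw [List.nil_append] at h1
    rw [pos_nil, mul_one] at h2
    have hcb : [b, a] <:+: wordIter σ 2 [a] := by
      have e3 : wordIter σ 2 [a] = (U₁.flatMap σ ++ U₂) ++ [b, a] ++ (s ++ V.flatMap σ) := by
        show ([a].flatMap σ).flatMap σ = _
        rw [List.flatMap_singleton, e]
        simp [List.flatMap_append, List.flatMap_cons, e2, h1]
      rw [e3]
      exact ⟨_, _, rfl⟩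
    obtain ⟨ω, pt, A, B, hl, -, -, -, -, hpt, -⟩ :=
      exists_leaf_of_seed (w := w) (g := v * (FreeGroup.of b)⁻¹) (p := q) (c := [b, a]) (s := s)
        hG.map_of hσ hq0 hs0 (by simp [List.flatMap_cons, hq, h1])
        (by
          rw [lift_mul, h2, map_inv, hG.map_of, hq, pos_append, pos_singleton]
          group) hcb
    refine ⟨ω, pt, hl, ⟨_, (hpt 1 (by simp)).trans ?_⟩, ⟨_, (hpt 2 (by simp)).trans ?_⟩⟩
    · show v * (FreeGroup.of b)⁻¹ * FreeGroup.of b = v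
      group
    · show v * (FreeGroup.of b)⁻¹ * pos [b, a] = _
      rw [pos_cons, pos_singleton]
      group
  · rcases eq_or_ne s [] with rfl | hs
    · obtain ⟨b₁, V₁, rfl⟩ := List.exists_cons_of_ne_nil hV
      obtain ⟨b, V₂, e2⟩ := List.exists_cons_of_ne_nil (hσ b₁)
      obtain ⟨q, hq⟩ := hG.first _ _ _ e2
      have hq0 : q ≠ [] := by
        rintro rfl
        have := hG.three_le b
        simp [hq] at this
      have hcb : [a, b] <:+: wordIter σ 2 [a] := by
        have e3 : wordIter σ 2 [a] = (U.flatMap σ ++ p) ++ [a, b] ++ (V₂ ++ V₁.flatMap σ) := by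
          show ([a].flatMap σ).flatMap σ = _
          rw [List.flatMap_singleton, e]
          simp [List.flatMap_append, List.flatMap_cons, e2, h1]
        rw [e3]
        exact ⟨_, _, rfl⟩
      obtain ⟨ω, pt, A, B, hl, -, -, -, -, hpt, -⟩ :=
        exists_leaf_of_seed (w := w) (g := v) (p := p) (c := [a, b]) (s := q)
          hG.map_of hσ hp hq0 (by simp [List.flatMap_cons, hq, h1]) h2 hcb
      refine ⟨ω, pt, hl, ⟨_, (hpt 0 (by simp)).trans ?_⟩, ⟨_, (hpt 1 (by simp)).trans rfl⟩⟩
      simp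
    · obtain ⟨ω, pt, A, B, hl, -, -, -, -, hpt, -⟩ :=
        exists_leaf_of_seed (w := w) (g := v) (p := p) (c := [a]) (s := s)
          hG.map_of hσ hp hs (by simp [h1]) h2 (m := 0) (b := a) (List.infix_refl _)
      refine ⟨ω, pt, hl, ⟨_, (hpt 0 (by simp)).trans ?_⟩, ⟨_, (hpt 1 (by simp)).trans rfl⟩⟩
      simp

/-! ### The ends of a leaf -/

/-- The right half of a bi-infinite positive word. -/
def fwd (ω : ℤ → Fin N) : Boundary N := ⟨fun i => (ω i, true), fun _ _ => rfl⟩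

/-- The left half of a bi-infinite positive word, read backwards. -/
def bwd (ω : ℤ → Fin N) : Boundary N := ⟨fun i => (ω (-1 - i), false), fun _ _ => rfl⟩

/-- The pair of ends of the bi-infinite word `ω`, seen from position `i`. -/
def ends (ω : ℤ → Fin N) (i : ℤ) : Boundary N × Boundary N :=
  (bwd fun j => ω (i + j), fwd fun j => ω (i + j))

section Line

variable {ω : ℤ → Fin N} {pt : ℤ → FreeGroup (Fin N)}

theorem pref_ends_snd (h : ∀ i, pt (i + 1) = pt i * FreeGroup.of (ω i)) (i : ℤ) (m : ℕ) :
    (ends ω i).2.pref m = (pt i)⁻¹ * pt (i + m) := by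
  induction m with
  | zero => simp [Boundary.pref, ← FreeGroup.one_eq_mk]
  | succ m ih =>
    rw [pref_succ, ih, mul_assoc]
    push_cast
    rw [← add_assoc, h]
    rfl

theorem pref_ends_fst (h : ∀ i, pt (i + 1) = pt i * FreeGroup.of (ω i)) (i : ℤ) (m : ℕ) :
    (ends ω i).1.pref m = (pt i)⁻¹ * pt (i - m) := by
  induction m with
  | zero => simp [Boundary.pref, ← FreeGroup.one_eq_mk]
  | succ m ih =>
    have h1 := h (i - m - 1)
    rw [sub_add_cancel] at h1
    rw [pref_succ, ih, mul_assoc, h1, mul_assoc]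
    have h2 : letter ((ends ω i).1.1 m) = (FreeGroup.of (ω (i - m - 1)))⁻¹ := by
      rw [← letter_false]
      show letter (ω (i + (-1 - m)), false) = _
      rw [show i + (-1 - (m : ℤ)) = i - m - 1 by ring]
    rw [h2, mul_inv_cancel, mul_one]
    push_cast
    rw [sub_sub]

theorem hd_pref_succ (X : Boundary N) (m : ℕ) : hd (X.pref (m + 1)) = some (X.1 0) := by
  rw [hd, toWord_pref, List.range_succ_eq_map]
  rfl

theorem hd_inv_mul_pt_of_lt (h : ∀ i, pt (i + 1) = pt i * FreeGroup.of (ω i)) {i j : ℤ}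
    (hij : i < j) : hd ((pt i)⁻¹ * pt j) = some (ω i, true) := by
  have h1 := pref_ends_snd h i ((j - i - 1).toNat + 1)
  rw [show i + (((j - i - 1).toNat + 1 : ℕ) : ℤ) = j by omega] at h1
  rw [← h1, hd_pref_succ]
  show some (ω (i + ((0 : ℕ) : ℤ)), true) = _
  simp

theorem hd_inv_mul_pt_of_gt (h : ∀ i, pt (i + 1) = pt i * FreeGroup.of (ω i)) {i j : ℤ}
    (hij : j < i) : hd ((pt i)⁻¹ * pt j) = some (ω (i - 1), false) := by
  have h1 := pref_ends_fst h i ((i - j - 1).toNat + 1)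
  rw [show i - (((i - j - 1).toNat + 1 : ℕ) : ℤ) = j by omega] at h1
  rw [← h1, hd_pref_succ]
  show some (ω (i + (-1 - ((0 : ℕ) : ℤ))), false) = _
  rw [show i + (-1 - ((0 : ℕ) : ℤ)) = i - 1 by simp; ring]

theorem tendsto_ends_snd (h : ∀ i, pt (i + 1) = pt i * FreeGroup.of (ω i)) (i : ℤ) {u : ℕ → ℤ}
    (hu : Tendsto u atTop atTop) :
    Tendsto (fun n => Compactification.word ((pt i)⁻¹ * pt (u n))) atTop
      (𝓝 (.point (ends ω i).2)) := by
  rw [tendsto_point_iff_follows]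
  intro j
  filter_upwards [hu.eventually_ge_atTop (i + j)] with n hn
  have := pref_ends_snd h i (u n - i).toNat
  rw [show i + ((u n - i).toNat : ℤ) = u n by omega] at this
  rw [← this]
  exact follows_pref _ (by omega)

theorem tendsto_ends_fst (h : ∀ i, pt (i + 1) = pt i * FreeGroup.of (ω i)) (i : ℤ) {u : ℕ → ℤ}
    (hu : Tendsto u atTop atBot) :
    Tendsto (fun n => Compactification.word ((pt i)⁻¹ * pt (u n))) atTop
      (𝓝 (.point (ends ω i).1)) := by
  rw [tendsto_point_iff_follows]
  intro j
  filter_upwards [hu.eventually_le_atBot (i - j)] with n hn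
  have := pref_ends_fst h i (i - u n).toNat
  rw [show i - ((i - u n).toNat : ℤ) = u n by omega] at this
  rw [← this]
  exact follows_pref _ (by omega)

theorem translate_eq {g : FreeGroup (Fin N)} {X Y : Boundary N}
    (h : Tendsto (fun n => Compactification.word (g * X.pref n)) atTop (𝓝 (.point Y))) :
    translate g X = Y :=
  point_eq_of_tendsto (exists_tendsto_mul g X).choose_spec h

theorem translate_ends (h : ∀ i, pt (i + 1) = pt i * FreeGroup.of (ω i)) (i j : ℤ) :
    translate ((pt j)⁻¹ * pt i) (ends ω i).1 = (ends ω j).1 ∧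
      translate ((pt j)⁻¹ * pt i) (ends ω i).2 = (ends ω j).2 := by
  constructor
  · refine translate_eq ?_
    simp only [pref_ends_fst h, mul_assoc, mul_inv_cancel_left]
    refine tendsto_ends_fst h j ?_
    exact tendsto_atBot_add_const_left _ _
      (tendsto_neg_atTop_atBot.comp tendsto_natCast_atTop_atTop)
  · refine translate_eq ?_
    simp only [pref_ends_snd h, mul_assoc, mul_inv_cancel_left]
    refine tendsto_ends_snd h j ?_
    exact tendsto_atTop_add_const_left _ _ tendsto_natCast_atTop_atTop

theorem shift_ends (h : ∀ i, pt (i + 1) = pt i * FreeGroup.of (ω i)) (i : ℤ) :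
    shift (ends ω i) = ends ω (i + 1) := by
  have e : (letter ((ends ω i).2.1 0))⁻¹ = (pt (i + 1))⁻¹ * pt i := by
    rw [h, mul_inv_rev, inv_mul_cancel_right]
    show (letter (ω (i + ((0 : ℕ) : ℤ)), true))⁻¹ = _
    simp [letter_true]
  obtain ⟨h1, h2⟩ := translate_ends h i (i + 1)
  rw [shift, e, h1, h2]

theorem shiftInv_ends (h : ∀ i, pt (i + 1) = pt i * FreeGroup.of (ω i)) (i : ℤ) :
    shiftInv (ends ω i) = ends ω (i - 1) := by
  have e : (letter ((ends ω i).1.1 0))⁻¹ = (pt (i - 1))⁻¹ * pt i := by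
    have h1 := h (i - 1)
    rw [sub_add_cancel] at h1
    rw [h1, inv_mul_cancel_left]
    show (letter (ω (i + (-1 - ((0 : ℕ) : ℤ))), false))⁻¹ = _
    rw [show i + (-1 - ((0 : ℕ) : ℤ)) = i - 1 by simp; ring, letter_false, inv_inv]
  obtain ⟨h1, h2⟩ := translate_ends h i (i - 1)
  rw [shiftInv, e, h1, h2]

theorem ends_mem_shiftOrbit (h : ∀ i, pt (i + 1) = pt i * FreeGroup.of (ω i)) (i : ℤ) :
    ends ω i ∈ shiftOrbit (ends ω 0) := by
  have h1 : ∀ n : ℕ, shift^[n] (ends ω 0) = ends ω n := by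
    intro n
    induction n with
    | zero => rfl
    | succ n ih => rw [Function.iterate_succ_apply', ih, shift_ends h]; push_cast; rfl
  have h2 : ∀ n : ℕ, shiftInv^[n] (ends ω 0) = ends ω (-n) := by
    intro n
    induction n with
    | zero => rfl
    | succ n ih =>
      rw [Function.iterate_succ_apply', ih, shiftInv_ends h]
      push_cast
      rw [neg_add, sub_eq_add_neg]
  rcases Int.eq_nat_or_neg i with ⟨n, rfl | rfl⟩
  · exact ⟨n, Or.inl (h1 n).symm⟩
  · exact ⟨n, Or.inr (h2 n).symm⟩

end Line

/-! ### Leaves and the attracting subshift -/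

theorem iterate_lift_mul (w : FreeGroup (Fin N)) (Φ : MulAut (FreeGroup (Fin N))) (n : ℕ)
    (g h : FreeGroup (Fin N)) :
    (lift w Φ)^[n] (g * h) = (lift w Φ)^[n] g * (Φ ^ n) h := by
  induction n with
  | zero => simp
  | succ n ih =>
    rw [Function.iterate_succ_apply', ih, lift_mul, Function.iterate_succ_apply', pow_succ',
      MulAut.mul_apply]

/-- The line generated by an edge labelled `a` whose image extends it at both ends is a generating
pair, and it contains every word `wordIter σ n [a]`. -/
theorem exists_isGeneratingPair {φ : MulAut (FreeGroup (Fin N))} {K : ℕ} (hK : 1 ≤ K)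
    {σ : Fin N → List (Fin N)} (hG : IsGood (φ ^ K) σ) (a : Fin N) :
    ∃ (ω : ℤ → Fin N) (pt : ℤ → FreeGroup (Fin N)),
      (∀ i, pt (i + 1) = pt i * FreeGroup.of (ω i)) ∧ IsGeneratingPair φ (ends ω 0) ∧
      ∀ n, ∃ k : ℤ, ∀ j : ℕ, j < (wordIter σ n [a]).length →
        (wordIter σ n [a])[j]? = some (ω (j - k)) := by
  have hσ : ∀ a, σ a ≠ [] := fun a h => by have := hG.three_le a; simp [h] at this
  obtain ⟨U, V, hU, hV, e⟩ := hG.mid a a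
  obtain ⟨ω, pt, A, B, hl, hA, hB, hptA, hptB, hpt, hω⟩ :=
    exists_leaf_of_seed (w := pos U) (Φ := φ ^ K) (g := 1) (p := U) (c := [a]) (s := V)
      hG.map_of hσ hU hV (by simp [e]) (by simp [lift]) (m := 0) (b := a) (List.infix_refl _)
  have hpt0 : pt 0 = 1 := by
    have := hpt 0 (by simp)
    simpa using this
  refine ⟨ω, pt, hl.step, ⟨a, K, pos U, pos V, hK, purePositive_pos hU, purePositive_pos hV,
    ?_, ?_, ?_⟩, fun n => ⟨A n, hω n⟩⟩
  · rw [hG.map_of, e, pos_append, pos_cons, mul_assoc]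
  · have h1 : ∀ n : ℕ, ((List.range n).map fun j => (φ ^ (j * K)) (pos U)⁻¹).prod =
        pt (-(A n : ℤ)) := by
      intro n
      rw [hptA]
      induction n with
      | zero => simp
      | succ n ih =>
        rw [List.range_succ, List.map_append, List.prod_append, ih, Function.iterate_succ_apply,
          show lift (pos U) (φ ^ K) 1 = 1 * (pos U)⁻¹ by simp [lift], iterate_lift_mul, ← pow_mul,
          mul_comm K n]
        simp
    have h2 := tendsto_ends_fst hl.step 0 (u := fun n => -(A (n + 1) : ℤ))
      (tendsto_neg_atTop_atBot.comp (tendsto_natCast_atTop_atTop.comp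
        (tendsto_atTop_mono (fun n => (Nat.le_succ n).trans (hA (n + 1))) tendsto_id)))
    rw [hpt0] at h2
    simp only [inv_one, one_mul, ← h1] at h2
    exact h2
  · have h1 : ∀ n : ℕ, FreeGroup.of a * ((List.range n).map fun j => (φ ^ (j * K)) (pos V)).prod =
        pt (B n : ℤ) := by
      intro n
      rw [hptB, one_mul, pos_singleton]
      induction n with
      | zero => simp
      | succ n ih =>
        rw [List.range_succ, List.map_append, List.prod_append, ← mul_assoc, ih,
          Function.iterate_succ_apply,
          show lift (pos U) (φ ^ K) (FreeGroup.of a) = FreeGroup.of a * pos V by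
            rw [lift, hG.map_of, e, pos_append, pos_cons, inv_mul_cancel_left],
          iterate_lift_mul, ← pow_mul, mul_comm K n]
        simp
    have h2 := tendsto_ends_snd hl.step 0 (u := fun n => (B (n + 1) : ℤ))
      (tendsto_natCast_atTop_atTop.comp
        (tendsto_atTop_mono (fun n => (Nat.le_succ n).trans (hB (n + 1))) tendsto_id))
    rw [hpt0] at h2
    simp only [inv_one, one_mul, ← h1] at h2
    exact h2

namespace IsLeaf

variable {w : FreeGroup (Fin N)} {Φ : MulAut (FreeGroup (Fin N))} {σ : Fin N → List (Fin N)}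
  {ω : ℤ → Fin N} {pt : ℤ → FreeGroup (Fin N)}

/-- Every finite subword of a leaf occurs in the generating pair, so a leaf seen from one of its
vertices lies in the attracting subshift. -/
theorem ends_mem_attractingSubshift {φ : MulAut (FreeGroup (Fin N))} {K : ℕ} (hK : 1 ≤ K)
    (h : IsLeaf w (φ ^ K) σ ω pt) (hG : IsGood (φ ^ K) σ) (i : ℤ) :
    ends ω i ∈ attractingSubshift φ := by
  refine ⟨?_, ?_⟩
  · intro hc
    have h1 := congrArg (fun X : Boundary N => (X.1 0).2) hc
    simp [ends, fwd, bwd] at h1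
  obtain ⟨ω₀, pt₀, hstep, hgen, hocc⟩ := exists_isGeneratingPair hK hG (ω 0)
  refine ⟨ends ω₀ 0, hgen, ?_⟩
  have hwin : ∀ R : ℕ, ∃ k : ℤ, ∀ j : ℤ, -(R : ℤ) ≤ j → j < R → ω₀ (k + j) = ω (i + j) := by
    intro R
    obtain ⟨m, b, k, hk⟩ := h.lang (R + i.natAbs)
    obtain ⟨U, V, -, -, e⟩ := hG.mid b (ω 0)
    obtain ⟨k₀, hk₀⟩ := hocc (m + 1)
    have e1 : wordIter σ (m + 1) [ω 0] =
        wordIter σ m U ++ (wordIter σ m [b] ++ wordIter σ m V) := by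
      rw [wordIter_succ', List.flatMap_singleton, e, ← List.singleton_append, wordIter_append,
        wordIter_append]
    refine ⟨i + k + (wordIter σ m U).length - k₀, fun j hj1 hj2 => ?_⟩
    obtain ⟨h1, h2⟩ := hk (i + j) (by omega) (by omega)
    obtain ⟨h3, -⟩ := List.getElem?_eq_some_iff.1 h2
    have h4 := hk₀ ((wordIter σ m U).length + (i + j + k).toNat) (by
      rw [e1, List.length_append, List.length_append]
      omega)
    rw [e1, List.getElem?_append_right (by omega), Nat.add_sub_cancel_left,
      List.getElem?_append_left h3, h2] at h4
    rw [Option.some_injective _ h4]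
    congr 1
    omega
  choose k hk using hwin
  refine mem_closure_of_tendsto (f := fun R : ℕ => ends ω₀ (k R)) (b := atTop) ?_
    (Eventually.of_forall fun R => ends_mem_shiftOrbit hstep (k R))
  refine Tendsto.prodMk_nhds ?_ ?_
  · refine tendsto_subtype_rng.2 (tendsto_pi_nhds.2 fun n => ?_)
    refine tendsto_const_nhds.congr' ?_
    filter_upwards [eventually_gt_atTop n] with R hR
    show (ω (i + (-1 - n)), false) = (ω₀ (k R + (-1 - n)), false)
    rw [hk R _ (by omega) (by omega)]
  · refine tendsto_subtype_rng.2 (tendsto_pi_nhds.2 fun n => ?_)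
    refine tendsto_const_nhds.congr' ?_
    filter_upwards [eventually_gt_atTop n] with R hR
    show (ω (i + n), true) = (ω₀ (k R + n), true)
    rw [hk R _ (by omega) (by omega)]

theorem exists_displacement (h : IsLeaf w Φ σ ω pt) (hG : IsGood Φ σ) :
    ∃ τ : ℤ → ℤ, (∀ i, lift w Φ (pt i) = pt (i + τ i)) ∧ StrictMono τ := by
  choose τ hτ using h.inv
  refine ⟨fun i => τ i - i, fun i => by rw [hτ]; congr 1; ring, ?_⟩
  convert h.strictMono_height_sub hG using 2 with i
  rw [hτ, h.height_pt (τ i), h.height_pt i]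
  ring

/-- Seen from its vertex `pt i`, both ends of a leaf are attracting for the conjugate of the
automorphism that corresponds to this base point. -/
theorem isAttractingPair (h : IsLeaf w Φ σ ω pt) (hG : IsGood Φ σ) (i : ℤ) :
    IsAttractingPair (inner (pt i) * (inner w * Φ) * inner (pt i)⁻¹) (ends ω i) := by
  obtain ⟨τ, hτ, hmono⟩ := h.exists_displacement hG
  have hup : ∀ n : ℕ, τ i + n ≤ τ (i + n) := by
    intro n
    induction n with
    | zero => simp
    | succ n ih =>
      have := hmono (show i + (n : ℤ) < i + ((n + 1 : ℕ) : ℤ) by push_cast; omega)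
      push_cast at *
      omega
  have hdown : ∀ n : ℕ, τ (i - n) + n ≤ τ i := by
    intro n
    induction n with
    | zero => simp
    | succ n ih =>
      have := hmono (show i - ((n + 1 : ℕ) : ℤ) < i - (n : ℤ) by push_cast; omega)
      push_cast at *
      omega
  set ψ := inner (pt i) * (inner w * Φ) * inner (pt i)⁻¹ with hψ
  set c := w * ((inner w * Φ) (pt i))⁻¹ * pt i with hc
  have happ : ∀ j, ψ ((pt i)⁻¹ * pt j) = (pt i)⁻¹ * pt (j + τ j) * c := by
    intro j
    have h1 : (inner w * Φ) (pt j) = pt (j + τ j) * w := by rw [inner_mul_apply, hτ]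
    have h2 : ψ ((pt i)⁻¹ * pt j) =
        (pt i)⁻¹ * (inner w * Φ) (pt j * (pt i)⁻¹) * pt i := by
      rw [hψ, MulAut.mul_apply, MulAut.mul_apply]
      simp only [inner, MulAut.conj_apply, inv_inv]
      rw [show pt i * ((pt i)⁻¹ * pt j) * (pt i)⁻¹ = pt j * (pt i)⁻¹ by group]
    rw [h2, map_mul, map_inv, h1, hc]
    group
  have g1 : Growth ψ (ends ω i).1 := by
    intro K
    filter_upwards [eventually_ge_atTop (τ i + K + c.norm).toNat] with m hm
    rw [pref_ends_fst h.step, happ]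
    have h1 := hdown m
    have h2 := pref_ends_fst h.step i (m - τ (i - m)).toNat
    rw [show i - (((m - τ (i - m)).toNat : ℕ) : ℤ) = i - m + τ (i - m) by omega] at h2
    rw [← h2]
    exact Follows.mul _ (follows_pref _ (by omega))
  have g2 : Growth ψ (ends ω i).2 := by
    intro K
    filter_upwards [eventually_ge_atTop (-τ i + K + c.norm).toNat] with m hm
    rw [pref_ends_snd h.step, happ]
    have h1 := hup m
    have h2 := pref_ends_snd h.step i (m + τ (i + m)).toNat
    rw [show i + (((m + τ (i + m)).toNat : ℕ) : ℤ) = i + m + τ (i + m) by omega] at h2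
    rw [← h2]
    exact Follows.mul _ (follows_pref _ (by omega))
  obtain ⟨e1, U₁, hU₁, h1⟩ := g1.isAttractingPoint
  obtain ⟨e2, U₂, hU₂, h2⟩ := g2.isAttractingPoint
  refine ⟨Prod.ext e1 e2, U₁ ×ˢ U₂, prod_mem_nhds hU₁ hU₂, fun y hy => ?_⟩
  simp only [Prod.map_iterate]
  exact (h1 _ hy.1).prodMk_nhds (h2 _ hy.2)

end IsLeaf

/-! ### Pairs of distinct leaves -/

theorem norm_letter_inv_mul {x : FreeGroup (Fin N)} {l : Fin N × Bool} (h : hd x = some l) :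
    ((letter l)⁻¹ * x).norm + 1 = x.norm := by
  obtain ⟨t, ht⟩ : ∃ t, x.toWord = l :: t := by
    rw [hd, List.head?_eq_some_iff] at h; exact h
  obtain ⟨h1, h2, -⟩ := toWord_cons ht
  rw [h1, FreeGroup.norm, h2, FreeGroup.norm, ht, List.length_cons]

section Leaves

variable {w : FreeGroup (Fin N)} {Φ : MulAut (FreeGroup (Fin N))} {σ : Fin N → List (Fin N)}

theorem IsLeaf.hd_inv_mul_of_mem_range {ω : ℤ → Fin N} {pt : ℤ → FreeGroup (Fin N)}
    (h : IsLeaf w Φ σ ω pt) {i : ℤ} {z : FreeGroup (Fin N)} (hz : z ∈ Set.range pt) :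
    hd ((pt i)⁻¹ * z) = none ∨ hd ((pt i)⁻¹ * z) = some (ω i, true) ∨
      hd ((pt i)⁻¹ * z) = some (ω (i - 1), false) := by
  obtain ⟨j, rfl⟩ := hz
  rcases lt_trichotomy i j with hij | rfl | hij
  · exact Or.inr (Or.inl (hd_inv_mul_pt_of_lt h.step hij))
  · simp
  · exact Or.inr (Or.inr (hd_inv_mul_pt_of_gt h.step hij))

/-- If the geodesic from the vertex `pt i` of a leaf to `g` leaves the leaf at once, and the lift
does not move `g` towards the leaf, then a crossing edge on this geodesic yields another leaf, which
comes closer to `pt i` than `g`. -/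
theorem IsLeaf.exists_other {ω : ℤ → Fin N} {pt : ℤ → FreeGroup (Fin N)}
    (h : IsLeaf w Φ σ ω pt) (hG : IsGood Φ σ) {i : ℤ} {g : FreeGroup (Fin N)} (hg : pt i ≠ g)
    (h1 : hd ((pt i)⁻¹ * g) ≠ some (ω i, true)) (h2 : hd ((pt i)⁻¹ * g) ≠ some (ω (i - 1), false))
    (h3 : hd (g⁻¹ * lift w Φ g) ≠ hd (g⁻¹ * pt i)) :
    ∃ ω' pt', IsLeaf w Φ σ ω' pt' ∧ Set.range pt ≠ Set.range pt' ∧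
      ∃ k, ((pt i)⁻¹ * pt' k).norm < ((pt i)⁻¹ * g).norm := by
  have hnone : hd ((pt i)⁻¹ * g) ≠ none := by
    rw [Ne, hd_eq_none, inv_mul_eq_one]
    exact hg
  have haway : ∀ z ∈ Set.range pt, hd ((pt i)⁻¹ * z) ≠ hd ((pt i)⁻¹ * g) := by
    intro z hz
    rcases h.hd_inv_mul_of_mem_range (i := i) hz with h4 | h4 | h4 <;> rw [h4]
    · exact hnone.symm
    · exact h1.symm
    · exact h2.symm
  obtain ⟨W₁, l, W₂, v, a, hW, hcr, hva⟩ := exists_crosses hG.map_of hg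
    (haway _ (by obtain ⟨j, hj⟩ := h.inv i; exact ⟨j, hj.symm⟩)) h3
  obtain ⟨ω', pt', hl', hv, hva'⟩ := hcr.exists_leaf hG
  obtain ⟨hx, hy⟩ : pt i * FreeGroup.mk W₁ ∈ Set.range pt' ∧
      pt i * FreeGroup.mk W₁ * letter l ∈ Set.range pt' := by
    rcases hva with ⟨e1, e2⟩ | ⟨e1, e2⟩
    · exact ⟨e1 ▸ hv, e2 ▸ hva'⟩
    · exact ⟨e1 ▸ hva', e2 ▸ hv⟩
  refine ⟨ω', pt', hl', fun he => ?_, ?_⟩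
  · rw [← he] at hy
    apply haway _ hy
    have hW' : ((pt i)⁻¹ * g).toWord = (W₁ ++ [l]) ++ W₂ := by rw [hW]; simp
    rw [mul_assoc, inv_mul_cancel_left, letter, ← mk_append, hd, hd,
      (norm_of_toWord_eq_append hW').1, hW']
    rcases W₁ with _ | ⟨b, t⟩ <;> rfl
  · obtain ⟨k, hk⟩ := hx
    refine ⟨k, ?_⟩
    rw [hk, inv_mul_cancel_left, FreeGroup.norm, FreeGroup.norm, hW,
      (norm_of_toWord_eq_append hW).1]
    simp

/-- Two leaves with different vertex sets exist. -/
def HasTwoLeaves (w : FreeGroup (Fin N)) (Φ : MulAut (FreeGroup (Fin N)))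
    (σ : Fin N → List (Fin N)) : Prop :=
  ∃ ω₁ pt₁ ω₂ pt₂, IsLeaf w Φ σ ω₁ pt₁ ∧ IsLeaf w Φ σ ω₂ pt₂ ∧ Set.range pt₁ ≠ Set.range pt₂

theorem IsLeaf.norm_next {ω : ℤ → Fin N} {pt : ℤ → FreeGroup (Fin N)} (h : IsLeaf w Φ σ ω pt)
    {i : ℤ} {g : FreeGroup (Fin N)} (h1 : hd ((pt i)⁻¹ * g) = some (ω i, true)) :
    ((pt (i + 1))⁻¹ * g).norm < ((pt i)⁻¹ * g).norm := by
  have := norm_letter_inv_mul h1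
  rw [← mul_assoc, ← mul_inv_rev, letter_true, ← h.step] at this
  omega

theorem IsLeaf.norm_prev {ω : ℤ → Fin N} {pt : ℤ → FreeGroup (Fin N)} (h : IsLeaf w Φ σ ω pt)
    {i : ℤ} {g : FreeGroup (Fin N)} (h1 : hd ((pt i)⁻¹ * g) = some (ω (i - 1), false)) :
    ((pt (i - 1))⁻¹ * g).norm < ((pt i)⁻¹ * g).norm := by
  have := norm_letter_inv_mul h1
  have h2 := h.step (i - 1)
  rw [sub_add_cancel] at h2
  rw [← mul_assoc, ← mul_inv_rev, letter_false, h2, mul_inv_cancel_right] at this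
  rw [h2]
  omega

/-- Two distinct leaves at positive distance are joined by a geodesic whose endpoints the lift moves
along the leaves. A crossing edge on it gives a third leaf that is closer to the first. Hence two
distinct leaves with a common vertex exist. -/
theorem HasTwoLeaves.exists_common_vertex (hG : IsGood Φ σ) (h : HasTwoLeaves w Φ σ) :
    ∃ ω₁ pt₁ ω₂ pt₂, IsLeaf w Φ σ ω₁ pt₁ ∧ IsLeaf w Φ σ ω₂ pt₂ ∧
      Set.range pt₁ ≠ Set.range pt₂ ∧ ∃ i j, pt₁ i = pt₂ j := by
  obtain ⟨ω₁, pt₁, ω₂, pt₂, hl₁, hl₂, hne⟩ := h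
  obtain ⟨n, hn⟩ : ∃ n, n = ((pt₁ 0)⁻¹ * pt₂ 0).norm := ⟨_, rfl⟩
  generalize (0 : ℤ) = i at hn
  generalize hj : (pt₂ _) = z at hn
  replace hj : ∃ j, pt₂ j = z := ⟨_, hj⟩
  obtain ⟨j, rfl⟩ := hj
  induction n using Nat.strong_induction_on generalizing ω₂ pt₂ i j with
  | _ n ih =>
    by_cases heq : pt₁ i = pt₂ j
    · exact ⟨_, _, _, _, hl₁, hl₂, hne, i, j, heq⟩
    by_cases h1 : hd ((pt₁ i)⁻¹ * pt₂ j) = some (ω₁ i, true)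
    · exact ih _ (hn ▸ hl₁.norm_next h1) ω₂ pt₂ hl₂ hne (i + 1) j rfl
    by_cases h2 : hd ((pt₁ i)⁻¹ * pt₂ j) = some (ω₁ (i - 1), false)
    · exact ih _ (hn ▸ hl₁.norm_prev h2) ω₂ pt₂ hl₂ hne (i - 1) j rfl
    by_cases h3 : hd ((pt₂ j)⁻¹ * pt₁ i) = some (ω₂ j, true)
    · have := hl₂.norm_next h3
      rw [norm_inv_mul_comm, norm_inv_mul_comm (pt₂ j), ← hn] at this
      exact ih _ this ω₂ pt₂ hl₂ hne i (j + 1) rfl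
    by_cases h4 : hd ((pt₂ j)⁻¹ * pt₁ i) = some (ω₂ (j - 1), false)
    · have := hl₂.norm_prev h4
      rw [norm_inv_mul_comm, norm_inv_mul_comm (pt₂ j), ← hn] at this
      exact ih _ this ω₂ pt₂ hl₂ hne i (j - 1) rfl
    have h5 : hd ((pt₂ j)⁻¹ * lift w Φ (pt₂ j)) ≠ hd ((pt₂ j)⁻¹ * pt₁ i) := by
      obtain ⟨k, hk⟩ := hl₂.inv j
      rcases hl₂.hd_inv_mul_of_mem_range (i := j) ⟨k, hk.symm⟩ with h5 | h5 | h5 <;> rw [h5]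
      · intro h6
        exact heq (inv_mul_eq_one.1 (hd_eq_none.1 h6.symm)).symm
      · exact Ne.symm h3
      · exact Ne.symm h4
    obtain ⟨ω₃, pt₃, hl₃, hne₃, k, hk⟩ := hl₁.exists_other hG heq h1 h2 h5
    exact ih _ (hn ▸ hk) ω₃ pt₃ hl₃ hne₃ i k rfl

/-- If the lift maps the first vertex of a cone into the cone, a leaf that avoids this cone is not
the only leaf: there is a crossing edge between the cone and the vertex of the leaf
closest to it. -/
theorem IsLeaf.hasTwoLeaves_of_avoids {ω : ℤ → Fin N} {pt : ℤ → FreeGroup (Fin N)}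
    (h : IsLeaf w Φ σ ω pt) (hG : IsGood Φ σ) {u : FreeGroup (Fin N)} {l : Fin N × Bool}
    (hu : Cone u l (lift w Φ (u * letter l))) (havoid : ∀ i, ¬ Cone u l (pt i)) :
    HasTwoLeaves w Φ σ := by
  set g := u * letter l with hg
  obtain ⟨i, hi⟩ : ∃ i, ∀ j, ((pt i)⁻¹ * g).norm ≤ ((pt j)⁻¹ * g).norm :=
    ⟨Function.argmin (fun i => ((pt i)⁻¹ * g).norm),
      fun j => Function.argmin_le (fun i => ((pt i)⁻¹ * g).norm) j⟩
  obtain ⟨ω', pt', hl', hne, -⟩ := h.exists_other hG (i := i) (g := g)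
    (fun he => havoid i (by rw [he]; exact cone_mul_letter u l))
    (fun he => (h.norm_next he).not_ge (hi _)) (fun he => (h.norm_prev he).not_ge (hi _))
    (by
      intro he
      have h1 := havoid i
      rw [cone_iff_not_cone_linv, not_not] at h1
      rw [cone_iff_not_cone_linv] at hu
      rw [Cone] at h1 hu
      exact hu (he.trans h1))
  exact ⟨_, _, _, _, h, hl', hne⟩

theorem exists_enters_of_lt {P : ℤ → Prop} {i j : ℤ} (hij : i ≤ j) (hi : ¬ P i) (hj : P j) :
    ∃ k, ¬ P k ∧ P (k + 1) := by
  by_contra hc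
  push Not at hc
  have : ∀ k, i ≤ k → ¬ P k := by
    intro k hk
    induction k, hk using Int.leInduction with
    | base => exact hi
    | succ k _ ih => exact hc k ih
  exact this j hij hj

/-- A line whose edges are all positive does not leave a cone that it has entered. -/
theorem IsLeaf.cone_of_between {ω : ℤ → Fin N} {pt : ℤ → FreeGroup (Fin N)}
    (h : IsLeaf w Φ σ ω pt) {u : FreeGroup (Fin N)} {l : Fin N × Bool} {i j k : ℤ} (hij : i ≤ j)
    (hjk : j ≤ k) (hi : ¬ Cone u l (pt i)) (hj : Cone u l (pt j)) : Cone u l (pt k) := by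
  by_contra hk
  obtain ⟨m, hm1, hm2⟩ := exists_enters_of_lt (P := fun i => Cone u l (pt i)) hij hi hj
  obtain ⟨n, hn1, hn2⟩ := exists_enters_of_lt (P := fun i => ¬ Cone u l (pt i)) hjk
    (not_not.2 hj) hk
  rw [h.step, ← letter_true] at hm2 hn2
  have e1 := (eq_of_cone_mul_letter hm1 hm2).2
  have e2 := (eq_of_not_cone_mul_letter (not_not.1 hn1) hn2).2
  have := congrArg Prod.snd e2
  rw [← e1] at this
  simp [linv] at this

/-- If the lift maps the first vertices of three disjoint cones into the respective cones, there are
two distinct leaves: a leaf meets at most two of the cones, since it meets each in a half-line. -/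
theorem hasTwoLeaves_of_three_cones (hG : IsGood Φ σ) {u : Fin 3 → FreeGroup (Fin N)}
    {l : Fin 3 → Fin N × Bool} (hu : ∀ i, Cone (u i) (l i) (lift w Φ (u i * letter (l i))))
    (hdisj : ∀ i j z, i ≠ j → Cone (u i) (l i) z → ¬ Cone (u j) (l j) z) :
    HasTwoLeaves w Φ σ := by
  have hdir : ∀ i j, i ≠ j → hd ((u i * letter (l i))⁻¹ * (u j * letter (l j))) =
      some (linv (l i)) := by
    intro i j hij
    have := hdisj j i _ hij.symm (cone_mul_letter (u j) (l j))
    rwa [cone_iff_not_cone_linv, not_not] at this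
  have hmove : ∀ i, hd ((u i * letter (l i))⁻¹ * lift w Φ (u i * letter (l i))) ≠
      some (linv (l i)) := by
    intro i
    have := hu i
    rwa [cone_iff_not_cone_linv] at this
  obtain ⟨-, -, -, v, a, -, hcr, -⟩ := exists_crosses (w := w) hG.map_of
    (g := u 0 * letter (l 0)) (h := u 1 * letter (l 1))
    (fun he => by
      have := hdir 0 1 (by decide)
      rw [he] at this
      simp at this)
    (by rw [hdir 0 1 (by decide)]; exact hmove 0) (by rw [hdir 1 0 (by decide)]; exact hmove 1)
  obtain ⟨ω, pt, hl, -, -⟩ := hcr.exists_leaf hG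
  by_cases hav : ∃ i, ∀ k, ¬ Cone (u i) (l i) (pt k)
  · obtain ⟨i, hi⟩ := hav
    exact hl.hasTwoLeaves_of_avoids hG (hu i) hi
  exfalso
  push Not at hav
  choose k hk using hav
  have key : ∀ a b c, a ≠ b → b ≠ c → k a ≤ k b → k b ≤ k c → False := by
    intro a b c hab hbc h1 h2
    exact hdisj b c _ hbc (hl.cone_of_between h1 h2 (hdisj a b _ hab (hk a)) (hk b)) (hk c)
  rcases le_total (k 0) (k 1) with h1 | h1 <;> rcases le_total (k 1) (k 2) with h2 | h2 <;>
    rcases le_total (k 0) (k 2) with h3 | h3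
  · exact key 0 1 2 (by decide) (by decide) h1 h2
  · exact key 0 1 2 (by decide) (by decide) h1 h2
  · exact key 0 2 1 (by decide) (by decide) h3 h2
  · exact key 2 0 1 (by decide) (by decide) h3 h1
  · exact key 1 0 2 (by decide) (by decide) h1 h3
  · exact key 1 2 0 (by decide) (by decide) h2 h3
  · exact key 2 1 0 (by decide) (by decide) h2 h1
  · exact key 2 1 0 (by decide) (by decide) h2 h1

/-- A nontrivial fixed element `z` moves every leaf to a different one, because it preserves the
change of height under the lift, which is injective on a leaf. -/
theorem Crosses.hasTwoLeaves (hG : IsGood Φ σ) {v z : FreeGroup (Fin N)} {a : Fin N}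
    (h : Crosses w Φ σ v a) (hz : (inner w * Φ) z = z) (hz1 : z ≠ 1) : HasTwoLeaves w Φ σ := by
  obtain ⟨ω₁, pt₁, hl₁, hv₁, -⟩ := h.exists_leaf hG
  obtain ⟨ω₂, pt₂, hl₂, hv₂, -⟩ := (h.mul_left hz).exists_leaf hG
  refine ⟨_, _, _, _, hl₁, hl₂, fun he => hz1 ?_⟩
  rw [← he] at hv₂
  obtain ⟨i, hi⟩ := hv₁
  obtain ⟨j, hj⟩ := hv₂
  have hij : i = j := by
    apply (hl₁.strictMono_height_sub hG).injective
    simp only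
    rw [hi, hj, lift_mul_of_fixed hz, height_mul, height_mul]
    ring
  rw [← hij, hi] at hj
  exact right_eq_mul.1 hj

/-- Let `z` be a fixed element, and let the lift not move the vertex `x` towards `1`. If `z`
displaces `x` by more than it displaces `1`, the geodesic from `x` to `z * x` starts towards `1` and
arrives from the direction of `z`. The lift moves neither of its ends inward, so it contains a
crossing edge. -/
theorem hasTwoLeaves_of_fixed (hG : IsGood Φ σ) {x z : FreeGroup (Fin N)} {l : Fin N × Bool}
    (hx : hd x⁻¹ = some (linv l)) (hmove : hd (x⁻¹ * lift w Φ x) ≠ some (linv l))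
    (hz : (inner w * Φ) z = z) (hfar : z.norm < (x⁻¹ * (z * x)).norm) : HasTwoLeaves w Φ σ := by
  have key : ∀ z : FreeGroup (Fin N), z.norm < (x⁻¹ * (z * x)).norm →
      hd (x⁻¹ * (z * x)) = some (linv l) := by
    intro z hz
    by_contra hc
    have h1 := norm_mul_of_hd_ne (a := x) (b := x⁻¹ * (z * x)) (by rw [hx]; exact Ne.symm hc)
    rw [mul_inv_cancel_left] at h1
    have h2 := FreeGroup.norm_mul_le z x
    omega
  have h1 := key z hfar
  have e : x⁻¹ * (z⁻¹ * x) = (x⁻¹ * (z * x))⁻¹ := by group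
  have h2 := key z⁻¹ (by rwa [e, FreeGroup.norm_inv_eq, FreeGroup.norm_inv_eq])
  have hz1 : z ≠ 1 := by
    rintro rfl
    simp at hfar
  obtain ⟨-, -, -, v, a, -, hcr, -⟩ := exists_crosses (w := w) hG.map_of (g := x) (h := z * x)
    (fun he => hz1 (right_eq_mul.1 he)) (by rw [h1]; exact hmove) (by
      rw [lift_mul_of_fixed hz, mul_inv_rev, mul_assoc, inv_mul_cancel_left, mul_assoc, h2]
      exact hmove)
  exact hcr.hasTwoLeaves hG hz hz1

end Leaves

/-! ### Fixed elements and attracting points -/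

/-- A commutative free group is cyclic. -/
theorem exists_zpow_of_comm {G : Type*} [Group G] [IsFreeGroup G] (h : ∀ x y : G, x * y = y * x) :
    ∃ r : G, ∀ x, ∃ n : ℤ, r ^ n = x := by
  classical
  set e := IsFreeGroup.toFreeGroup G with he
  have hsub : (Set.range (FreeGroup.of : IsFreeGroup.Generators G → _)).Subsingleton := by
    rintro _ ⟨s, rfl⟩ _ ⟨t, rfl⟩
    by_contra hne
    have hst : s ≠ t := fun h => hne (by rw [h])
    have h1 := congrArg e (h (e.symm (FreeGroup.of s)) (e.symm (FreeGroup.of t)))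
    rw [map_mul, map_mul, MulEquiv.apply_symm_apply, MulEquiv.apply_symm_apply, FreeGroup.of,
      FreeGroup.of, FreeGroup.mul_mk, FreeGroup.mul_mk] at h1
    have h2 := FreeGroup.reduce.sound h1
    have hred : ∀ a b : IsFreeGroup.Generators G,
        FreeGroup.IsReduced ([(a, true)] ++ [(b, true)]) := by
      intro a b
      simp [FreeGroup.IsReduced]
    rw [(hred s t).reduce_eq, (hred t s).reduce_eq] at h2
    simp at h2
    exact hst h2.1
  obtain ⟨r, hr⟩ : ∃ r, Set.range (FreeGroup.of : IsFreeGroup.Generators G → _) ⊆ {r} := by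
    rcases hsub.eq_empty_or_singleton with h1 | ⟨r, h1⟩
    · exact ⟨1, by rw [h1]; exact Set.empty_subset _⟩
    · exact ⟨r, h1.subset⟩
  refine ⟨e.symm r, fun x => ?_⟩
  have h1 : e x ∈ Subgroup.closure {r} :=
    Subgroup.closure_mono hr (by rw [FreeGroup.closure_range_of]; trivial)
  obtain ⟨n, hn⟩ := Subgroup.mem_closure_singleton.1 h1
  exact ⟨n, by rw [← map_zpow, hn, MulEquiv.symm_apply_apply]⟩

/-- An automorphism that fixes a nontrivial element fixes everything that commutes with it, because
commuting elements are powers of a common element and roots in free groups are unique. -/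
theorem map_eq_self_of_commute {ψ : MulAut (FreeGroup (Fin N))} {u c : FreeGroup (Fin N)}
    (hu : ψ u = u) (hu1 : u ≠ 1) (hc : c * u = u * c) : ψ c = c := by
  have hcomm : ∀ x ∈ ({u, c} : Set (FreeGroup (Fin N))), ∀ y ∈ ({u, c} : Set (FreeGroup (Fin N))),
      x * y = y * x := by
    rintro x (rfl | rfl) y (rfl | rfl)
    · rfl
    · exact hc.symm
    · exact hc
    · rfl
  obtain ⟨r, hr⟩ := exists_zpow_of_comm
    (G := Subgroup.closure ({u, c} : Set (FreeGroup (Fin N)))) (by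
      have := Subgroup.isMulCommutative_closure hcomm
      exact fun x y => this.is_comm.comm x y)
  obtain ⟨i, hi⟩ := hr ⟨u, Subgroup.subset_closure (by simp)⟩
  obtain ⟨j, hj⟩ := hr ⟨c, Subgroup.subset_closure (by simp)⟩
  have hi' : (r : FreeGroup (Fin N)) ^ i = u := by
    have := congrArg Subtype.val hi
    simpa using this
  have hj' : (r : FreeGroup (Fin N)) ^ j = c := by
    have := congrArg Subtype.val hj
    simpa using this
  have hi0 : i ≠ 0 := by
    rintro rfl
    exact hu1 (by rw [← hi', zpow_zero])
  have hfix : ψ (r : FreeGroup (Fin N)) = r := by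
    apply zpow_left_injective hi0
    simp only
    rw [← map_zpow, hi', hu]
  rw [← hj', map_zpow, hfix]

section

variable {w : FreeGroup (Fin N)} {Φ : MulAut (FreeGroup (Fin N))} {σ : Fin N → List (Fin N)}

/-- Far along a ray with growth, the lift pushes vertices outward. -/
theorem Growth.eventually_cone {X : Boundary N} (h : Growth (inner w * Φ) X) :
    ∀ᶠ m in atTop, Cone (X.pref m) (X.1 m) (lift w Φ (X.pref m * letter (X.1 m))) := by
  filter_upwards [(tendsto_add_atTop_nat 1).eventually (h w⁻¹.norm)] with m hm
  have h1 := hm.mul w⁻¹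
  rwa [inner_mul_apply, mul_inv_cancel_right, follows_succ_iff_cone, pref_succ] at h1

/-- Neighbourhoods of three distinct points in the boundary contain disjoint cones. -/
theorem hasTwoLeaves_of_three_points (hG : IsGood Φ σ) {X : Fin 3 → Boundary N}
    (hX : Function.Injective X) (h : ∀ i, Growth (inner w * Φ) (X i)) : HasTwoLeaves w Φ σ := by
  have h1 : ∀ i j, ∀ᶠ m in atTop, i ≠ j → ∀ z, Cone ((X i).pref m) ((X i).1 m) z →
      ¬ Cone ((X j).pref m) ((X j).1 m) z := by
    intro i j
    by_cases hij : i = j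
    · exact Eventually.of_forall fun m hne => absurd hij hne
    obtain ⟨n, hn⟩ : ∃ n, (X i).1 n ≠ (X j).1 n := by
      by_contra hc
      push Not at hc
      exact hij (hX (Subtype.ext (funext hc)))
    filter_upwards [eventually_ge_atTop n] with m hm _ z hz hz'
    rw [← follows_succ_iff_cone] at hz hz'
    exact hn (Option.some_injective _ ((hz n (by omega)).symm.trans (hz' n (by omega))))
  obtain ⟨m, hm1, hm2⟩ := ((eventually_all.2 fun i => (h i).eventually_cone).and
    (eventually_all.2 fun i => eventually_all.2 fun j => h1 i j)).exists
  exact hasTwoLeaves_of_three_cones hG (u := fun i => (X i).pref m) (l := fun i => (X i).1 m) hm1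
    fun i j z hij => hm2 i j hij z

/-- If `u` displaced the prefixes of `X` by a bounded amount, `X` would be an end of the axis of
`u`, along which the automorphism displaces by a bounded amount, against growth. -/
theorem hasTwoLeaves_of_growth_of_fixed (hG : IsGood Φ σ) {X : Boundary N}
    (h : Growth (inner w * Φ) X) {u : FreeGroup (Fin N)} (hu : (inner w * Φ) u = u) (hu1 : u ≠ 1) :
    HasTwoLeaves w Φ σ := by
  by_contra hno
  have h1 : ∀ᶠ m in atTop,
      ((X.pref (m + 1))⁻¹ * (u * X.pref (m + 1))).norm ≤ u.norm := by
    filter_upwards [h.eventually_cone] with m hm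
    by_contra hc
    refine hno (hasTwoLeaves_of_fixed hG (hd_inv_pref_succ X m) ?_ hu (not_le.1 hc))
    rw [cone_iff_not_cone_linv, ← pref_succ] at hm
    exact hm
  -- for infinitely many `m`, the element `X.pref (m + 1) * (X.pref (m₀ + 1))⁻¹` centralizes `u`,
  -- and hence is fixed
  obtain ⟨d, hd⟩ := exists_frequently_eq h1.frequently
  obtain ⟨m₀, hm₀⟩ := hd.exists
  set e := (X.pref (m₀ + 1))⁻¹ * (inner w * Φ) (X.pref (m₀ + 1)) with he
  obtain ⟨m, hm, hgrow⟩ := (hd.and_eventually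
    ((tendsto_add_atTop_nat 1).eventually (h (e.norm + 1)))).exists
  have hfix := map_eq_self_of_commute (c := X.pref (m + 1) * (X.pref (m₀ + 1))⁻¹) hu hu1 (by
    have e1 : u * X.pref (m + 1) = X.pref (m + 1) * d := by rw [← hm]; group
    have e2 : (X.pref (m₀ + 1))⁻¹ * u = d * (X.pref (m₀ + 1))⁻¹ := by rw [← hm₀]; group
    rw [mul_assoc, e2, ← mul_assoc, ← e1, mul_assoc])
  have e3 : (X.pref (m + 1))⁻¹ * (inner w * Φ) (X.pref (m + 1)) = e := by
    rw [map_mul, map_inv] at hfix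
    have e4 : (inner w * Φ) (X.pref (m + 1)) =
        X.pref (m + 1) * (X.pref (m₀ + 1))⁻¹ * (inner w * Φ) (X.pref (m₀ + 1)) := by
      rw [← hfix]; group
    rw [e4, he]
    group
  have h2 := (hgrow.mono (Nat.le_add_right (m + 1) _)).norm_inv_mul
  have h3 := hgrow.le_norm
  rw [e3] at h2
  omega

/-- Let `u = t * r * t⁻¹` with `r` cyclically reduced with last letter `e`, so that `t` lies on the
axis of `u`. If the lift does not move `t` backward along the axis, it does not move the vertices
`u ^ n * t` backward either, that is, towards `1`. A fixed element `z` that does not commute with `u`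
displaces `u ^ n * t` by more than `z.norm` for some `n`, and `hasTwoLeaves_of_fixed` applies. -/
theorem hasTwoLeaves_of_axis (hG : IsGood Φ σ) {t r : List (Fin N × Bool)} {e : Fin N × Bool}
    (hred : FreeGroup.IsReduced (t ++ r ++ FreeGroup.invRev t))
    (hr : FreeGroup.IsCyclicallyReduced r) (he : r.getLast? = some e) {u z : FreeGroup (Fin N)}
    (hut : u = FreeGroup.mk (t ++ r ++ FreeGroup.invRev t)) (hu : (inner w * Φ) u = u)
    (hz : (inner w * Φ) z = z) (hzu : z * u ≠ u * z)
    (hmove : hd ((FreeGroup.mk t)⁻¹ * lift w Φ (FreeGroup.mk t)) ≠ some (linv e)) :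
    HasTwoLeaves w Φ σ := by
  have hut' : u = FreeGroup.mk t * FreeGroup.mk r * (FreeGroup.mk t)⁻¹ := by
    rw [hut, mk_append, mk_append, FreeGroup.inv_mk]
  have hx : ∀ n, u ^ (n + 1) * FreeGroup.mk t =
      FreeGroup.mk (t ++ (List.replicate (n + 1) r).flatten) := by
    intro n
    rw [hut', conj_pow, FreeGroup.pow_mk, inv_mul_cancel_right, mk_append]
  have hhd : ∀ n, hd (u ^ (n + 1) * FreeGroup.mk t)⁻¹ = some (linv e) := by
    intro n
    have h1 := FreeGroup.IsReduced.append_flatten_replicate_append hr hred (n := n + 1) (by omega)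
    have h2 : FreeGroup.IsReduced (t ++ (List.replicate (n + 1) r).flatten) :=
      h1.infix ⟨[], FreeGroup.invRev t, by simp⟩
    rw [hx, hd_inv, toWord_mk_of_isReduced h2, List.getLast?_append,
      List.getLast?_flatten_replicate (h := by omega), he]
    rfl
  have hpow : ∀ n, (inner w * Φ) (u ^ n) = u ^ n := fun n => by rw [map_pow, hu]
  by_contra hno
  have hle : ∀ n, ((u ^ (n + 1) * FreeGroup.mk t)⁻¹ * (z * (u ^ (n + 1) * FreeGroup.mk t))).norm ≤
      z.norm := by
    intro n
    by_contra hc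
    refine hno (hasTwoLeaves_of_fixed hG (hhd n) ?_ hz (not_le.1 hc))
    rw [lift_mul_of_fixed (hpow _), mul_inv_rev, mul_assoc, inv_mul_cancel_left]
    exact hmove
  obtain ⟨d, hd⟩ := exists_frequently_eq (Eventually.of_forall hle : ∀ᶠ n in atTop, _).frequently
  obtain ⟨n, hn⟩ := hd.exists
  obtain ⟨m, hm, hnm⟩ := (hd.and_eventually (eventually_gt_atTop n)).exists
  obtain ⟨k, rfl⟩ := Nat.exists_eq_add_of_lt hnm
  apply hzu
  have h1 : z * u ^ (k + 1) * z⁻¹ = u ^ (k + 1) := by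
    have h2 := hm.trans hn.symm
    rw [show n + k + 1 + 1 = (k + 1) + (n + 1) by ring, pow_add, mul_assoc (u ^ (k + 1))] at h2
    generalize u ^ (n + 1) * FreeGroup.mk t = y at h2
    have h3 := congrArg (fun g => u ^ (k + 1) * y * g * y⁻¹) h2
    simp only [mul_assoc, mul_inv_rev, mul_inv_cancel, mul_inv_cancel_left, mul_one] at h3
    rw [mul_inv_eq_iff_eq_mul, h3]
  rw [← conj_pow] at h1
  have h2 := pow_left_injective (Nat.succ_ne_zero k) h1
  rwa [mul_inv_eq_iff_eq_mul] at h2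

/-- The lift does not move a vertex on the axis of `u` both backward and forward along the axis, so
`hasTwoLeaves_of_axis` applies to `u` or to `u⁻¹`. -/
theorem hasTwoLeaves_of_not_commute (hG : IsGood Φ σ) {u z : FreeGroup (Fin N)}
    (hu : (inner w * Φ) u = u) (hz : (inner w * Φ) z = z) (hzu : z * u ≠ u * z) :
    HasTwoLeaves w Φ σ := by
  set t := FreeGroup.reduceCyclically.conjugator u.toWord with ht
  set r := FreeGroup.reduceCyclically u.toWord with hr
  have hdec : t ++ r ++ FreeGroup.invRev t = u.toWord :=
    FreeGroup.reduceCyclically.conj_conjugator_reduceCyclically _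
  have hcyc : FreeGroup.IsCyclicallyReduced r :=
    FreeGroup.reduceCyclically.isCyclicallyReduced FreeGroup.isReduced_toWord
  have hr0 : r ≠ [] := by
    intro h
    apply hzu
    have : u = 1 := by
      rw [← FreeGroup.mk_toWord (x := u), ← hdec, h, List.append_nil, mk_append, ← FreeGroup.inv_mk,
        mul_inv_cancel]
    rw [this, one_mul, mul_one]
  have hred : FreeGroup.IsReduced (t ++ r ++ FreeGroup.invRev t) :=
    hdec ▸ FreeGroup.isReduced_toWord
  obtain ⟨e, he⟩ : ∃ e, r.getLast? = some e := ⟨_, List.getLast?_eq_some_getLast hr0⟩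
  obtain ⟨f, hf⟩ : ∃ f, r.head? = some f := ⟨_, List.head?_eq_some_head hr0⟩
  by_cases hmove : hd ((FreeGroup.mk t)⁻¹ * lift w Φ (FreeGroup.mk t)) = some (linv e)
  · have hdec' : t ++ FreeGroup.invRev r ++ FreeGroup.invRev t = u⁻¹.toWord := by
      rw [FreeGroup.toWord_inv, ← hdec]
      simp [FreeGroup.invRev_append, FreeGroup.invRev_invRev]
    have hred' : FreeGroup.IsReduced (t ++ FreeGroup.invRev r ++ FreeGroup.invRev t) :=
      hdec' ▸ FreeGroup.isReduced_toWord
    have hlast : (FreeGroup.invRev r).getLast? = some (linv f) := by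
      rw [FreeGroup.invRev, List.getLast?_reverse, List.head?_map, hf]
      rfl
    have hhead : (FreeGroup.invRev r).head? = some (linv e) := by
      rw [FreeGroup.invRev, List.head?_reverse, List.getLast?_map, he]
      rfl
    refine hasTwoLeaves_of_axis hG hred' ⟨hred'.infix ⟨t, FreeGroup.invRev t, rfl⟩, ?_⟩ hlast
      (u := u⁻¹) (by rw [hdec', FreeGroup.mk_toWord]) (by rw [map_inv, hu]) hz ?_ ?_
    · intro a ha b hb hab
      rw [hlast, Option.mem_some_iff] at ha
      rw [hhead, Option.mem_some_iff] at hb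
      subst ha hb
      have := hcyc.2 e he f hf hab.symm
      simp [linv, this]
    · intro hc
      apply hzu
      have := congrArg (fun g => u * g * u) hc
      simpa [mul_assoc] using this.symm
    · rw [hmove, linv_linv]
      intro hc
      have hc' : linv e = f := Option.some_injective _ hc
      have h1 : e.1 = f.1 := by rw [← hc']; rfl
      have h2 := hcyc.2 e he f hf h1
      rw [← hc'] at h2
      simp [linv] at h2
  · exact hasTwoLeaves_of_axis hG hred hcyc he (by rw [hdec, FreeGroup.mk_toWord]) hu hz hzu hmove

end

/-! ### The index -/

theorem three_points_of_lt_attractingClassCount {ψ : MulAut (FreeGroup (Fin N))}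
    (h : 2 < attractingClassCount ψ) :
    ∃ X : Fin 3 → Boundary N, Function.Injective X ∧ ∀ i, X i ∈ attractingPoints ψ := by
  have h3 : (3 : ℕ∞) ≤ attractingClassCount ψ := by
    have := Order.add_one_le_of_lt h
    rwa [two_add_one_eq_three] at this
  obtain ⟨T, hT, hcard⟩ := Set.exists_subset_encard_eq h3
  obtain ⟨a, b, c, hab, hac, hbc, rfl⟩ := Set.encard_eq_three.1 hcard
  obtain ⟨X, hX, hXa⟩ := hT (show a ∈ _ by simp)
  obtain ⟨Y, hY, hYb⟩ := hT (show b ∈ _ by simp)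
  obtain ⟨Z, hZ, hZc⟩ := hT (show c ∈ _ by simp)
  have hXY : X ≠ Y := fun h => hab (by rw [hXa, hYb, h])
  have hXZ : X ≠ Z := fun h => hac (by rw [hXa, hZc, h])
  have hYZ : Y ≠ Z := fun h => hbc (by rw [hYb, hZc, h])
  refine ⟨![X, Y, Z], ?_, ?_⟩
  · intro i j hij
    fin_cases i <;> fin_cases j <;> simp_all
  · intro i
    fin_cases i <;> simp_all

/-- Positive index means that the rank of the fixed subgroup is `0` and there are at least three
orbits of attracting points, or the rank is `1` and there is an attracting point, or the rank is at
least `2`. A fixed subgroup of rank at least `2` is not commutative. -/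
theorem cases_of_index_pos {ψ : MulAut (FreeGroup (Fin N))} (h : 0 < index ψ) :
    (∃ X : Fin 3 → Boundary N, Function.Injective X ∧ ∀ i, X i ∈ attractingPoints ψ) ∨
      (∃ u, ψ u = u ∧ u ≠ 1 ∧ ∃ X, X ∈ attractingPoints ψ) ∨
      ∃ u z, ψ u = u ∧ ψ z = z ∧ z * u ≠ u * z := by
  by_cases hcomm : ∀ x y : fixedSubgroup ψ, x * y = y * x
  swap
  · push Not at hcomm
    obtain ⟨x, y, hxy⟩ := hcomm
    exact Or.inr (Or.inr ⟨y, x, y.2, x.2, fun hc => hxy (Subtype.ext hc)⟩)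
  by_cases hbot : fixedSubgroup ψ = ⊥
  · left
    apply three_points_of_lt_attractingClassCount
    by_contra hle
    have hrank : subgroupRank (fixedSubgroup ψ) = 0 := by
      rw [← nonpos_iff_eq_zero]
      exact (iInf_le _ ⟨∅, by rw [hbot, Subgroup.closure_empty]⟩).trans (by simp)
    have h1 : ((attractingClassCount ψ : ENNReal) : EReal) ≤ 2 := by
      refine (EReal.coe_ennreal_le_coe_ennreal_iff.2
        (ENat.toENNReal_le.2 (not_lt.1 hle))).trans_eq ?_
      norm_num
      rfl
    rw [index, hrank] at h
    refine h.not_ge ?_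
    have h3 : ((attractingClassCount ψ : ENNReal) : EReal) - 2 ≤ 0 := EReal.sub_nonpos.2 h1
    have h4 := EReal.div_nonpos_of_nonpos_of_nonneg h3 (by norm_num : (0 : EReal) ≤ 2)
    simpa using h4
  · right
    left
    obtain ⟨u, hu1⟩ := Subgroup.ne_bot_iff_exists_ne_one.1 hbot
    refine ⟨u, u.2, fun h => hu1 (Subtype.ext h), ?_⟩
    by_contra hno
    push Not at hno
    have hcount : attractingClassCount ψ = 0 := by
      rw [attractingClassCount, Set.encard_eq_zero, Set.eq_empty_iff_forall_notMem]
      rintro O ⟨X, hX, -⟩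
      exact hno X hX
    obtain ⟨r, hr⟩ := exists_zpow_of_comm hcomm
    have hrank : subgroupRank (fixedSubgroup ψ) ≤ 1 := by
      refine (iInf_le _ ⟨{(r : FreeGroup (Fin N))}, ?_⟩).trans (by simp)
      apply le_antisymm
      · rw [Subgroup.closure_le]
        simp
      · intro x hx
        obtain ⟨n, hn⟩ := hr ⟨x, hx⟩
        rw [Subgroup.mem_closure_singleton]
        exact ⟨n, by simpa using congrArg Subtype.val hn⟩
    have hrank' : ((subgroupRank (fixedSubgroup ψ) : ENNReal) : EReal) ≤ 1 := by
      have h2 := EReal.coe_ennreal_le_coe_ennreal_iff.2 (ENat.toENNReal_le.2 hrank)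
      simpa using h2
    rw [index, hcount] at h
    refine h.not_ge ?_
    have e : (((0 : ℕ∞) : ENNReal) : EReal) - 2 = ((-2 : ℝ) : EReal) := by
      simp
      rfl
    have e2 : ((-2 : ℝ) : EReal) / 2 = ((-1 : ℝ) : EReal) := by
      have : ((-2 : ℝ) : EReal) / ((2 : ℝ) : EReal) = ((-1 : ℝ) : EReal) := by
        rw [← EReal.coe_div]
        norm_num
      exact this
    rw [e, e2]
    refine (add_le_add_left hrank' _).trans ?_
    have : (1 : EReal) + ((-1 : ℝ) : EReal) = ((1 + -1 : ℝ) : EReal) := by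
      rw [EReal.coe_add]; rfl
    rw [this]
    norm_num

/-! ### The attracting pairs -/

theorem inner_mul_pow (w : FreeGroup (Fin N)) (Φ : MulAut (FreeGroup (Fin N))) (n : ℕ) :
    ∃ w', (inner w * Φ) ^ n = inner w' * Φ ^ n := by
  induction n with
  | zero => exact ⟨1, by ext g; simp [inner]⟩
  | succ n ih =>
    obtain ⟨w', hw'⟩ := ih
    refine ⟨(Φ ^ n) w * w', ?_⟩
    rw [pow_succ, hw', pow_succ]
    apply MulEquiv.ext
    intro g
    simp [inner, mul_assoc]

/-- Two distinct leaves through a common vertex have different pairs of ends at this vertex. -/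
theorem ends_ne_of_range_ne {ω₁ ω₂ : ℤ → Fin N} {pt₁ pt₂ : ℤ → FreeGroup (Fin N)}
    (h₁ : ∀ i, pt₁ (i + 1) = pt₁ i * FreeGroup.of (ω₁ i))
    (h₂ : ∀ i, pt₂ (i + 1) = pt₂ i * FreeGroup.of (ω₂ i)) {i j : ℤ} (hij : pt₁ i = pt₂ j)
    (hne : Set.range pt₁ ≠ Set.range pt₂) : ends ω₁ i ≠ ends ω₂ j := by
  intro he
  have key : ∀ k : ℤ, pt₁ (i + k) = pt₂ (j + k) := by
    intro k
    rcases Int.eq_nat_or_neg k with ⟨m, rfl | rfl⟩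
    · have h3 := pref_ends_snd h₁ i m
      rw [he, pref_ends_snd h₂ j m, hij] at h3
      exact (mul_left_cancel h3).symm
    · have h3 := pref_ends_fst h₁ i m
      rw [he, pref_ends_fst h₂ j m, hij] at h3
      simpa [sub_eq_add_neg] using (mul_left_cancel h3).symm
  apply hne
  ext z
  constructor
  · rintro ⟨k, rfl⟩
    exact ⟨j + (k - i), by rw [← key]; congr 1; ring⟩
  · rintro ⟨k, rfl⟩
    exact ⟨i + (k - j), by rw [key]; congr 1; ring⟩

end FreeBoundary

theorem mainTheorem6 (N : ℕ) (hN : 2 ≤ N) (φ : MulAut (FreeGroup (Fin N)))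
    (hpos : FreeBoundary.IsPositiveAut φ) (hprim : FreeBoundary.IsPrimitiveAut φ)
    (ψ : MulAut (FreeGroup (Fin N))) (hψ : ψ ∈ FreeBoundary.outerClassUnion φ)
    (hind : 0 < FreeBoundary.index ψ) :
    ∃ (h : ℕ) (ψ' : MulAut (FreeGroup (Fin N))),
      1 ≤ h ∧ FreeBoundary.Isogredient (ψ ^ h) ψ' ∧
      ∃ W₁ ∈ FreeBoundary.attractingSubshift φ, ∃ W₂ ∈ FreeBoundary.attractingSubshift φ,
        W₁ ≠ W₂ ∧ FreeBoundary.IsAttractingPair ψ' W₁ ∧ FreeBoundary.IsAttractingPair ψ' W₂ := by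
  open FreeBoundary in
  obtain ⟨w₀, k, hk, hψk⟩ := hψ
  obtain ⟨h, hh, hgood⟩ := exists_isGood hN hpos hprim
  obtain ⟨σ, hG⟩ := hgood k hk
  obtain ⟨w, hw⟩ : ∃ w, ψ ^ h = inner w * φ ^ (h * k) := by
    obtain ⟨w, hw⟩ := inner_mul_pow w₀ (φ ^ k) h
    exact ⟨w, by rw [hψk, hw, ← pow_mul, mul_comm k h]⟩
  have hfix : ∀ u, ψ u = u → (inner w * φ ^ (h * k)) u = u := by
    intro u hu
    rw [← hw]
    clear hw hG hgood hh
    induction h with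
    | zero => rfl
    | succ n ih => rw [pow_succ, MulAut.mul_apply, hu, ih]
  -- the points attracting for `ψ` are points of growth for `ψ ^ h` as well
  have hgrow : ∀ X ∈ attractingPoints ψ, Growth (inner w * φ ^ (h * k)) X := by
    intro X hX
    rw [← hw]
    exact (growth_of_mem_attractingPoints hX).pow hh
  have htwo : HasTwoLeaves w (φ ^ (h * k)) σ := by
    rcases cases_of_index_pos hind with ⟨X, hX, hatt⟩ | ⟨u, hu, hu1, X, hX⟩ | ⟨u, z, hu, hz, hzu⟩
    · exact hasTwoLeaves_of_three_points hG hX fun i => hgrow _ (hatt i)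
    · exact hasTwoLeaves_of_growth_of_fixed hG (hgrow _ hX) (hfix _ hu) hu1
    · exact hasTwoLeaves_of_not_commute hG (hfix _ hu) (hfix _ hz) hzu
  obtain ⟨ω₁, pt₁, ω₂, pt₂, hl₁, hl₂, hne, i, j, hij⟩ := htwo.exists_common_vertex hG
  have hK : 1 ≤ h * k := Nat.mul_pos hh hk
  -- conjugation by the common vertex moves this vertex to the base point `1` of the Cayley tree
  refine ⟨h, inner (pt₁ i) * (inner w * φ ^ (h * k)) * inner (pt₁ i)⁻¹, hh, ⟨pt₁ i, by rw [hw]⟩,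
    ends ω₁ i, hl₁.ends_mem_attractingSubshift hK hG i,
    ends ω₂ j, hl₂.ends_mem_attractingSubshift hK hG j,
    ends_ne_of_range_ne hl₁.step hl₂.step hij hne, hl₁.isAttractingPair hG i, ?_⟩
  rw [hij]
  exact hl₂.isAttractingPair hG j
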